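/- **Setting.** Fix $\varepsilon\in(0,1)$ and a sequence of alphabet sizes $m=m(n)\ge 1$ with $n=o(m)$ and $m=o(n^2)$ as $n\to\infty$. For each $n$ let $Z_1,\dots,Z_n$ be i.i.d. with values in $[m]=\{1,\dots,m\}$. Let $p$ be the uniform p.m.f. on $[m]$, let $d_{TV}(q,p)=\sup_{B\subseteq[m]}|q(B)-p(B)|$, and let $\mathcal Q_n$ be the set of p.m.f.s $q$ on $[m]$ with $d_{TV}(q,p)\ge\varepsilon$. For a test $\phi=\{\phi_n\}$, $\phi_n:[m]^n\to\{0,1\}$, put $P_F(\phi_n)=\mathsf P_p\{\phi_n=1\}$, $P_M(\phi_n)=\sup_{q\in\mathcal Q_n}\mathsf P_q\{\phi_n=0\}$, and define the generalized error exponents (in $[-\infty,\infty]$, with $\log 0=-\infty$) $$J_F(\phi)=-\limsup_{n\to\infty}\frac{m}{n^2}\log P_F(\phi_n),\qquad J_M(\phi)=-\limsup_{n\to\infty}\frac{m}{n^2}\log P_M(\phi_n).$$ Let $\kappa(\varepsilon)=1+4\varepsilon^2$ for $\varepsilon<\tfrac12$ and $\kappa(\varepsilon)=1+\varepsilon/(1-\varepsilon)$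 for $\varepsilon\ge\tfrac12$, and for $\tau\in[0,\kappa(\varepsilon)-1]$ let $$J_F^*(\tau)=\sup_{\theta\ge0}\Bigl\{\theta\tau-\tfrac12\bigl(e^{2\theta}-(1+2\theta)\bigr)\Bigr\},\qquad J_M^*(\tau)=\sup_{\theta\ge0}\Bigl\{\theta(\kappa(\varepsilon)-1-\tau)-\tfrac12\bigl(e^{-2\theta}-(1-2\theta)\bigr)\kappa(\varepsilon)\Bigr\}.$$ **Theorem (modified coincidence test).** Let $N_j$ be the number of $i\le n$ with $Z_i=j$. Let $\bar l<\infty$ and let $v_2,\dots,v_{\bar l}$ be real numbers, not depending on $n$, with $v_2=0$ and $v_l\ge0$ for $3\le l\le\bar l$. Define $$S_n^{*+}=-\sum_{j=1}^m\mathbb I\{N_j=1\}+\sum_{j=1}^m\sum_{l=2}^{\bar l}v_l\,\mathbb I\{N_j=l\}$$ and the test $\phi^{*+}_n=\mathbb I\{S_n^{*+}-\mathsf E_p[S_n^{*+}]\ge\tau_n\}$. Then for every $\tau\in[0,\kappa(\varepsilon)-1]$ and every sequence of thresholds with $\lim_{n\to\infty}m\tau_n/n^2=\tau$, $$J_F(\phi^{*+})=J_F^*(\tau)\qquad\text{and}\qquad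 J_M(\phi^{*+})=J_M^*(\tau).$$ -/

import Mathlib

open Filter Topology Asymptotics

open scoped NNReal ENNReal

namespace SmallSample

noncomputable section

/-- The number of times the symbol `j` occurs in the sample `z` (that is, `n Γⁿ_j`). -/
def symbCount {n m : ℕ} (z : Fin n → Fin m) (j : Fin m) : ℕ :=
  (Finset.univ.filter fun i => z i = j).card

/-- The uniform p.m.f. on an alphabet with `m` symbols. P.m.f.s are elements of
`stdSimplex ℝ (Fin m)`. -/
def unif (m : ℕ) : Fin m → ℝ := fun _ => 1 / (m : ℝ)

/-- The probability of the sample `z` when its letters are i.i.d. with p.m.f. `q`. -/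
def iidWeight {n m : ℕ} (q : Fin m → ℝ) (z : Fin n → Fin m) : ℝ := ∏ i, q (z i)

/-- Expectation of `S(Z₁, …, Z_n)` for `Z₁, …, Z_n` i.i.d. with p.m.f. `q`. -/
def iidExpect {n m : ℕ} (q : Fin m → ℝ) (S : (Fin n → Fin m) → ℝ) : ℝ :=
  ∑ z, iidWeight q z * S z

/-- Probability, for `Z₁, …, Z_n` i.i.d. with p.m.f. `q`, that the test `φ` returns `b`. -/
def decisionProb {n m : ℕ} (q : Fin m → ℝ) (φ : (Fin n → Fin m) → Bool) (b : Bool) : ℝ :=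
  ∑ z with φ z = b, iidWeight q z

/-- Total variation distance `sup_B |q(B) - p(B)|` (a supremum over finitely many sets). -/
def tvDist {m : ℕ} (q p : Fin m → ℝ) : ℝ :=
  ⨆ B : Finset (Fin m), |∑ j ∈ B, q j - ∑ j ∈ B, p j|

/-- The alternative hypothesis: p.m.f.s at total variation distance at least `ε` from uniform. -/
def altSet (ε : ℝ) (m : ℕ) : Set (Fin m → ℝ) :=
  {q | q ∈ stdSimplex ℝ (Fin m) ∧ ε ≤ tvDist q (unif m)}

/-- Probability of false alarm (the value `true` of a test means deciding for the alternative). -/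
def probFA {n m : ℕ} (φ : (Fin n → Fin m) → Bool) : ℝ≥0∞ :=
  ENNReal.ofReal (decisionProb (unif m) φ true)

/-- Worst-case probability of missed detection. -/
def probMD (ε : ℝ) {n m : ℕ} (φ : (Fin n → Fin m) → Bool) : ℝ≥0∞ :=
  ⨆ q ∈ altSet ε m, ENNReal.ofReal (decisionProb q φ false)

/-- `-limsup_n (1 / r) log P_n` with the normalization `r = n² / m`, where `log 0 = -∞`. -/
def genExponent (m : ℕ → ℕ) (P : ℕ → ℝ≥0∞) : EReal :=
  -limsup (fun n : ℕ => (((1 / ((n : ℝ) ^ 2 / (m n : ℝ))) : ℝ) : EReal) * ENNReal.log (P n)) atTop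

/-- Generalized error exponent of false alarm. -/
def expFA (m : ℕ → ℕ) (φ : ∀ n, (Fin n → Fin (m n)) → Bool) : EReal :=
  genExponent m fun n => probFA (φ n)

/-- Generalized error exponent of missed detection. -/
def expMD (ε : ℝ) (m : ℕ → ℕ) (φ : ∀ n, (Fin n → Fin (m n)) → Bool) : EReal :=
  genExponent m fun n => probMD ε (φ n)

/-- The function `κ(ε)`. -/
def kappa (ε : ℝ) : ℝ := if ε < 1 / 2 then 1 + 4 * ε ^ 2 else 1 + ε / (1 - ε)

/-- `J_F^*(τ) = sup_{θ ≥ 0} {θ τ - (e^{2θ} - (1 + 2θ)) / 2}`. -/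
def optFA (τ : ℝ) : EReal :=
  ⨆ θ : ℝ≥0, ((θ * τ - 1 / 2 * (Real.exp (2 * θ) - (1 + 2 * θ)) : ℝ) : EReal)

/-- `J_M^*(τ) = sup_{θ ≥ 0} {θ (κ(ε) - 1 - τ) - (e^{-2θ} - (1 - 2θ)) κ(ε) / 2}`. -/
def optMD (ε τ : ℝ) : EReal :=
  ⨆ θ : ℝ≥0, ((θ * (kappa ε - 1 - τ)
    - 1 / 2 * (Real.exp (-2 * θ) - (1 - 2 * θ)) * kappa ε : ℝ) : EReal)

/-- The coincidence statistic: minus the number of symbols that occur exactly once. -/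
def coincStat {n m : ℕ} (z : Fin n → Fin m) : ℝ :=
  -∑ j, if symbCount z j = 1 then (1 : ℝ) else 0

/-- The modified coincidence statistic: `v l` is added for each symbol that occurs exactly `l`
times, `2 ≤ l ≤ L`. -/
def modStat (L : ℕ) (v : ℕ → ℝ) {n m : ℕ} (z : Fin n → Fin m) : ℝ :=
  coincStat z + ∑ j, ∑ l ∈ Finset.Icc 2 L, v l * if symbCount z j = l then (1 : ℝ) else 0

open Classical in
/-- The modified coincidence test with threshold `t`: decide for the alternative if and only if
the statistic exceeds its mean under the uniform p.m.f. by at least `t`. -/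
def modTest (L : ℕ) (v : ℕ → ℝ) (n m : ℕ) (t : ℝ) (z : Fin n → Fin m) : Bool :=
  decide (t ≤ modStat L v z - iidExpect (unif m) (modStat L v : (Fin n → Fin m) → ℝ))

end

end SmallSample

open SmallSample

namespace SmallSample

noncomputable section

/-! Write r = n²/m. The counts sum to n, so the statistic plus n is `∑ j, modFun L v (N j)`: the
number of letters taking part in coincidences, plus the bonuses v_l. This is squeezed between the
sums of `coincFun` and of `coincFunUp V`, V = v_3 + ... + v_L. Both envelopes are nondecreasing in
every count, and both agree with `modFun` at 0, 1 and 2 because v_2 = 0. Under the uniform p.m.f.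
only pairs matter to first order, so the centred threshold becomes a threshold (1 + τ + o(1)) r for
this sum (`tendsto_threshold`).

Monotonicity makes Poissonization cheap. The expectation of a monotone function of the counts is
monotone in the sample size, so n letters can be compared with a Poisson(ρn) number of letters for a
fixed ρ near 1, on the side dictated by the inequality wanted. The error is exp(-cn), negligible at
scale r since n/r = m/n → ∞. After Poissonization the counts are independent and expectations of
products factor (`hasSum_countExpect_prod`).

Upper bounds on the error probabilities are Chernoff bounds. For false alarm, `tiltedGen_le` expands
the factor of one symbol to second order. For missed detection the bound must be uniform over
alternatives, some of which have large atoms where that expansion fails. The quadratic gain is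
therefore replaced by its tangents (`exists_tangent_bound`), whose slopes come from a bounded dual
certificate for the minimum of m ∑ q² over the alternative (`exists_dual`); this produces κ(ε).

Lower bounds come from a single event: exactly k symbols occur twice and none more often. Its
Poissonized probability is at least about that of {Poisson(Λ) = k} with Λ ≈ n² ∑ q² / 2
(`le_poisson_pairs`, `eventually_le_pairBound`). Taking k ≈ (1 + τ) r / 2, with q uniform for false
alarm and q two-valued with m ∑ q² → κ(ε) for missed detection (`exists_least_favourable`), gives a
Poisson large deviations rate. That rate is the value of the Chernoff objective at its maximizer, so
the two sides meet. -/

/-- Expectation of a function of the vector of symbol counts of an i.i.d. sample of size `n`. -/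
def countExpect {m : ℕ} (q : Fin m → ℝ) (n : ℕ) (F : (Fin m → ℕ) → ℝ) : ℝ :=
  iidExpect q fun z : Fin n → Fin m => F (symbCount z)

/-! ### Count vectors, generating functions and Poissonization -/

lemma prod_comp_eq_prod_pow_symbCount {R : Type*} [CommMonoid R] {n m : ℕ} (f : Fin m → R)
    (z : Fin n → Fin m) : ∏ i, f (z i) = ∏ j, f j ^ symbCount z j := by
  rw [← Finset.prod_fiberwise_of_maps_to (s := Finset.univ) (t := Finset.univ) (g := z)
    (fun _ _ => Finset.mem_univ _)]
  refine Finset.prod_congr rfl fun j _ => ?_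
  rw [symbCount, Finset.prod_congr rfl (g := fun _ => f j), Finset.prod_const]
  intro i hi
  rw [(Finset.mem_filter.1 hi).2]

lemma iidWeight_eq {n m : ℕ} (q : Fin m → ℝ) (z : Fin n → Fin m) :
    iidWeight q z = ∏ j, q j ^ symbCount z j :=
  prod_comp_eq_prod_pow_symbCount q z

lemma iidWeight_nonneg {n m : ℕ} {q : Fin m → ℝ} (hq : ∀ j, 0 ≤ q j) (z : Fin n → Fin m) :
    0 ≤ iidWeight q z := Finset.prod_nonneg fun _ _ => hq _

lemma sum_iidWeight {n m : ℕ} {q : Fin m → ℝ} (hq : ∑ j, q j = 1) :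
    ∑ z : Fin n → Fin m, iidWeight q z = 1 := by
  have h := Finset.sum_pow' (Finset.univ : Finset (Fin m)) q n
  simp only [hq, one_pow, Fintype.piFinset_univ] at h
  exact h.symm

/-- The sum of a function of the count vector over all samples, through multinomials. -/
lemma sum_symbCount {n m : ℕ} (H : (Fin m → ℕ) → ℝ) :
    ∑ z : Fin n → Fin m, H (symbCount z)
      = ∑ k ∈ Finset.piAntidiag Finset.univ n, (Nat.multinomial Finset.univ k : ℝ) * H k := by
  classical
  -- The linear functional taking the monomial X^k to H k turns the two expansions of (∑ X_j)^n,
  -- over words and over exponent vectors, into the two sides of the claim.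
  let Φ : MvPolynomial (Fin m) ℝ →ₗ[ℝ] ℝ :=
    (MvPolynomial.basisMonomials (Fin m) ℝ).constr ℝ fun d => H d
  have hΦ : ∀ k : Fin m → ℕ, Φ (∏ j, MvPolynomial.X j ^ k j) = H k := by
    intro k
    have h1 : (∏ j, (MvPolynomial.X j : MvPolynomial (Fin m) ℝ) ^ k j)
        = MvPolynomial.basisMonomials (Fin m) ℝ (Finsupp.equivFunOnFinite.symm k) := by
      simp only [MvPolynomial.coe_basisMonomials]
      rw [MvPolynomial.monomial_eq, Finsupp.prod_fintype]
      · simp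
      · simp
    rw [h1, Module.Basis.constr_basis]
    rfl
  have h := Finset.sum_pow' (Finset.univ : Finset (Fin m))
    (fun j => (MvPolynomial.X j : MvPolynomial (Fin m) ℝ)) n
  rw [Finset.sum_pow_eq_sum_piAntidiag, Fintype.piFinset_univ] at h
  have h2 := congrArg Φ h
  rw [map_sum, map_sum] at h2
  calc ∑ z : Fin n → Fin m, H (symbCount z)
      = ∑ z : Fin n → Fin m, Φ (∏ i, MvPolynomial.X (z i)) := by
        refine Finset.sum_congr rfl fun z _ => ?_
        rw [prod_comp_eq_prod_pow_symbCount (fun j => (MvPolynomial.X j : MvPolynomial (Fin m) ℝ)),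
          hΦ]
    _ = _ := by
        rw [← h2]
        refine Finset.sum_congr rfl fun k _ => ?_
        rw [← nsmul_eq_mul, map_nsmul, hΦ, nsmul_eq_mul]

/-- Exponential generating function of the expectations of a product of functions of the
counts. -/
lemma countExpect_prod {m : ℕ} (q : Fin m → ℝ) (n : ℕ) (g : Fin m → ℕ → ℝ) :
    countExpect q n (fun N => ∏ j, g j (N j)) = n.factorial *
      PowerSeries.coeff n (∏ j, PowerSeries.mk fun l => g j l * q j ^ l / l.factorial) := by
  classical
  have h1 : countExpect q n (fun N => ∏ j, g j (N j))
      = ∑ z : Fin n → Fin m,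
        (fun N : Fin m → ℕ => (∏ j, q j ^ N j) * ∏ j, g j (N j)) (symbCount z) := by
    simp only [countExpect, iidExpect, iidWeight_eq]
  rw [h1, sum_symbCount fun N : Fin m → ℕ => (∏ j, q j ^ N j) * ∏ j, g j (N j),
    PowerSeries.coeff_prod, Finset.mul_sum]
  have h2 : ∀ f : (Fin m → ℕ) → ℝ, ∑ l ∈ Finset.finsuppAntidiag (Finset.univ : Finset (Fin m)) n,
      f l = ∑ k ∈ Finset.piAntidiag (Finset.univ : Finset (Fin m)) n, f k := by
    intro f
    refine Finset.sum_bij (fun l _ => (l : Fin m → ℕ)) ?_ ?_ ?_ ?_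
    · intro l hl
      simpa using (Finset.mem_finsuppAntidiag.1 hl).1
    · intro l _ l' _ h
      exact DFunLike.coe_injective h
    · intro k hk
      refine ⟨Finsupp.equivFunOnFinite.symm k, ?_, rfl⟩
      simpa using hk
    · intros; rfl
  rw [h2 fun l => n.factorial * ∏ j, PowerSeries.coeff (l j)
    (PowerSeries.mk fun l => g j l * q j ^ l / l.factorial)]
  refine Finset.sum_congr rfl fun k hk => ?_
  have hk' : ∑ j, k j = n := (Finset.mem_piAntidiag.1 hk).1
  have h3 := Nat.multinomial_spec (Finset.univ : Finset (Fin m)) k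
  rw [hk'] at h3
  have h4 : (∏ j, ((k j).factorial : ℝ)) * (Nat.multinomial Finset.univ k : ℝ) = n.factorial := by
    exact_mod_cast h3
  have h5 : (∏ j, ((k j).factorial : ℝ)) ≠ 0 :=
    Finset.prod_ne_zero_iff.2 fun j _ => by positivity
  simp only [PowerSeries.coeff_mk, Finset.prod_div_distrib, Finset.prod_mul_distrib]
  rw [← h4]
  field_simp

/-- Product of nonnegative summable power series. -/
lemma hasSum_coeff_prod {ι : Type*} (s : Finset ι) (G : ι → PowerSeries ℝ) (x : ℝ) (T : ι → ℝ)
    (h0 : ∀ i l, 0 ≤ PowerSeries.coeff l (G i) * x ^ l)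
    (hT : ∀ i, HasSum (fun l => PowerSeries.coeff l (G i) * x ^ l) (T i)) :
    (∀ l, 0 ≤ PowerSeries.coeff l (∏ i ∈ s, G i) * x ^ l) ∧
    HasSum (fun l => PowerSeries.coeff l (∏ i ∈ s, G i) * x ^ l) (∏ i ∈ s, T i) := by
  classical
  induction s using Finset.induction_on with
  | empty =>
    simp only [Finset.prod_empty, PowerSeries.coeff_one]
    constructor
    · intro l; split_ifs with h <;> simp [h]
    · convert hasSum_ite_eq (0 : ℕ) (1 : ℝ) using 2 with l
      split_ifs with h <;> simp [h]
  | insert a s ha ih =>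
    obtain ⟨ih0, ih1⟩ := ih
    have hmul : ∀ l, PowerSeries.coeff l (∏ i ∈ insert a s, G i) * x ^ l
        = ∑ p ∈ Finset.HasAntidiagonal.antidiagonal l, (PowerSeries.coeff p.1 (G a) * x ^ p.1) *
            (PowerSeries.coeff p.2 (∏ i ∈ s, G i) * x ^ p.2) := by
      intro l
      rw [Finset.prod_insert ha, PowerSeries.coeff_mul, Finset.sum_mul]
      refine Finset.sum_congr rfl fun p hp => ?_
      rw [← Finset.HasAntidiagonal.mem_antidiagonal.1 hp, pow_add]
      ring
    constructor
    · intro l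
      rw [hmul]
      exact Finset.sum_nonneg fun p _ => mul_nonneg (h0 _ _) (ih0 _)
    · simp_rw [hmul]
      rw [Finset.prod_insert ha]
      have n1 : Summable fun l => ‖PowerSeries.coeff l (G a) * x ^ l‖ := by
        simpa only [Real.norm_of_nonneg (h0 a _)] using (hT a).summable
      have n2 : Summable fun l => ‖PowerSeries.coeff l (∏ i ∈ s, G i) * x ^ l‖ := by
        simpa only [Real.norm_of_nonneg (ih0 _)] using ih1.summable
      have := tsum_mul_tsum_eq_tsum_sum_antidiagonal_of_summable_norm n1 n2
      rw [(hT a).tsum_eq, ih1.tsum_eq] at this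
      rw [this]
      exact (summable_norm_sum_mul_antidiagonal_of_summable_norm n1 n2).of_norm.hasSum

/-- Poissonization: with a Poisson number of letters the counts are independent. -/
lemma hasSum_countExpect_prod {m : ℕ} {q : Fin m → ℝ} (hq : ∀ j, 0 ≤ q j) {μ : ℝ} (hμ : 0 ≤ μ)
    {g : Fin m → ℕ → ℝ} (hg : ∀ j l, 0 ≤ g j l) {T : Fin m → ℝ}
    (hT : ∀ j, HasSum (fun l => g j l * (q j * μ) ^ l / l.factorial) (T j)) :
    HasSum (fun n => μ ^ n / n.factorial * countExpect q n (fun N => ∏ j, g j (N j)))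
      (∏ j, T j) := by
  have h := (hasSum_coeff_prod Finset.univ
    (fun j => PowerSeries.mk fun l => g j l * q j ^ l / l.factorial) μ T ?_ ?_).2
  · convert h using 2 with n
    rw [countExpect_prod]
    have : (n.factorial : ℝ) ≠ 0 := by positivity
    field_simp
  · intro j l
    rw [PowerSeries.coeff_mk]
    have := hg j l
    have := hq j
    positivity
  · intro j
    convert hT j using 2 with l
    rw [PowerSeries.coeff_mk]
    ring

/-! ### Expectations of functions of the counts, and their monotonicity in the sample size -/

lemma countExpect_mono {m n : ℕ} {q : Fin m → ℝ} (hq : ∀ j, 0 ≤ q j) {F G : (Fin m → ℕ) → ℝ}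
    (h : ∀ N, F N ≤ G N) : countExpect q n F ≤ countExpect q n G :=
  Finset.sum_le_sum fun z _ => mul_le_mul_of_nonneg_left (h _) (iidWeight_nonneg hq z)

lemma countExpect_nonneg {m n : ℕ} {q : Fin m → ℝ} (hq : ∀ j, 0 ≤ q j) {F : (Fin m → ℕ) → ℝ}
    (h : ∀ N, 0 ≤ F N) : 0 ≤ countExpect q n F :=
  Finset.sum_nonneg fun z _ => mul_nonneg (iidWeight_nonneg hq z) (h _)

lemma countExpect_const {m n : ℕ} {q : Fin m → ℝ} (hq : ∑ j, q j = 1) (c : ℝ) :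
    countExpect q n (fun _ => c) = c := by
  simp only [countExpect, iidExpect]
  rw [← Finset.sum_mul, sum_iidWeight hq, one_mul]

lemma countExpect_sum {m n : ℕ} {q : Fin m → ℝ} {ι : Type*} (s : Finset ι)
    (F : ι → (Fin m → ℕ) → ℝ) :
    countExpect q n (fun N => ∑ i ∈ s, F i N) = ∑ i ∈ s, countExpect q n (F i) := by
  simp only [countExpect, iidExpect, Finset.mul_sum]
  exact Finset.sum_comm

lemma countExpect_const_mul {m n : ℕ} {q : Fin m → ℝ} (c : ℝ) (F : (Fin m → ℕ) → ℝ) :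
    countExpect q n (fun N => c * F N) = c * countExpect q n F := by
  simp only [countExpect, iidExpect, Finset.mul_sum]
  exact Finset.sum_congr rfl fun z _ => by ring

lemma symbCount_cons {n m : ℕ} (a : Fin m) (z : Fin n → Fin m) :
    symbCount (Fin.cons a z : Fin (n + 1) → Fin m) = symbCount z + Pi.single a 1 := by
  funext j
  simp only [symbCount, Pi.add_apply, Finset.card_filter, Fin.sum_univ_succ, Fin.cons_zero,
    Fin.cons_succ, Pi.single_apply, eq_comm (a := j)]
  exact add_comm _ _

lemma countExpect_succ {m : ℕ} (q : Fin m → ℝ) (n : ℕ) (F : (Fin m → ℕ) → ℝ) :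
    countExpect q (n + 1) F
      = ∑ a, q a * countExpect q n (fun N => F (N + Pi.single a 1)) := by
  simp only [countExpect, iidExpect]
  rw [← (Fin.consEquiv fun _ => Fin m).sum_comp, Fintype.sum_prod_type]
  refine Finset.sum_congr rfl fun a _ => ?_
  rw [Finset.mul_sum]
  refine Finset.sum_congr rfl fun z _ => ?_
  have h : symbCount ((Fin.consEquiv fun _ => Fin m) (a, z)) = symbCount z + Pi.single a 1 :=
    symbCount_cons a z
  rw [h]
  simp only [Fin.consEquiv_apply, iidWeight, Fin.prod_univ_succ, Fin.cons_zero,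
    Fin.cons_succ, mul_assoc]

/-- Appending one more letter can only raise the counts; average over that letter. -/
lemma countExpect_monotone {m : ℕ} {q : Fin m → ℝ} (hq : q ∈ stdSimplex ℝ (Fin m))
    {F : (Fin m → ℕ) → ℝ} (hF : Monotone F) : Monotone fun n => countExpect q n F := by
  refine monotone_nat_of_le_succ fun n => ?_
  rw [countExpect_succ]
  calc countExpect q n F = ∑ a, q a * countExpect q n F := by
        rw [← Finset.sum_mul, hq.2, one_mul]
    _ ≤ _ := Finset.sum_le_sum fun a _ => mul_le_mul_of_nonneg_left
        (countExpect_mono hq.1 fun N => hF (le_add_of_nonneg_right (by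
          intro j; simp [Pi.single_apply]))) (hq.1 a)

lemma countExpect_neg {m n : ℕ} {q : Fin m → ℝ} (F : (Fin m → ℕ) → ℝ) :
    countExpect q n (fun N => -F N) = -countExpect q n F := by
  simpa using countExpect_const_mul (q := q) (n := n) (-1) F

lemma countExpect_antitone {m : ℕ} {q : Fin m → ℝ} (hq : q ∈ stdSimplex ℝ (Fin m))
    {F : (Fin m → ℕ) → ℝ} (hF : Antitone F) : Antitone fun n => countExpect q n F := by
  have h := countExpect_monotone hq (F := fun N => -F N) fun a b hab => neg_le_neg (hF hab)
  intro a b hab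
  simpa [countExpect_neg] using h hab

/-! ### Depoissonization -/

/-- The Chernoff exponent of a Poisson variable of mean `ρ n` at `n`, divided by `n`. -/
def poissonGap (ρ : ℝ) : ℝ := ρ - 1 - Real.log ρ

lemma poissonGap_pos {ρ : ℝ} (h0 : 0 < ρ) (h1 : ρ ≠ 1) : 0 < poissonGap ρ := by
  have := Real.log_lt_sub_one_of_pos h0 h1
  unfold poissonGap; linarith

lemma hasSum_pow_div_factorial (x : ℝ) :
    HasSum (fun k : ℕ => x ^ k / k.factorial) (Real.exp x) := by
  rw [Real.exp_eq_exp_ℝ]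
  exact NormedSpace.expSeries_div_hasSum_exp x

/-- The mean of ρ^(n-K) for K Poisson of mean ρn, before normalization by exp(ρn). This tilt is at
least 1 on the side of n away from ρn, so it dominates the indicator of the bad event there. -/
lemma hasSum_tilted {ρ : ℝ} (h0 : 0 < ρ) (n : ℕ) :
    HasSum (fun k : ℕ => (ρ * n) ^ k / k.factorial * ((1 / ρ) ^ k * ρ ^ n))
      (Real.exp (ρ * n) * Real.exp (-(poissonGap ρ * n))) := by
  have h := (hasSum_pow_div_factorial (n : ℝ)).mul_right (ρ ^ n)
  have h1 : Real.exp (ρ * n) * Real.exp (-(poissonGap ρ * n)) = Real.exp n * ρ ^ n := by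
    rw [← Real.exp_add, poissonGap,
      show ρ * n + -((ρ - 1 - Real.log ρ) * n) = (n : ℝ) + n * Real.log ρ by ring, Real.exp_add,
      Real.exp_nat_mul, Real.exp_log h0]
  rw [h1]
  refine h.congr_fun fun k => ?_
  rw [mul_pow, div_pow, one_pow]
  field_simp

lemma one_le_tilt_of_le {ρ : ℝ} (h0 : 0 < ρ) (h1 : ρ ≤ 1) {k n : ℕ} (h : n ≤ k) :
    1 ≤ (1 / ρ) ^ k * ρ ^ n := by
  obtain ⟨d, rfl⟩ := Nat.exists_eq_add_of_le h
  rw [pow_add, mul_right_comm, ← mul_pow, one_div_mul_cancel h0.ne', one_pow, one_mul]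
  exact one_le_pow₀ ((one_le_div h0).2 h1)

lemma one_le_tilt_of_ge {ρ : ℝ} (h1 : 1 ≤ ρ) {k n : ℕ} (h : k ≤ n) :
    1 ≤ (1 / ρ) ^ k * ρ ^ n := by
  have h0 : 0 < ρ := by linarith
  obtain ⟨d, rfl⟩ := Nat.exists_eq_add_of_le h
  rw [pow_add, ← mul_assoc, ← mul_pow, one_div_mul_cancel h0.ne', one_pow, one_mul]
  exact one_le_pow₀ h1

lemma tilt_nonneg {ρ : ℝ} (h0 : 0 < ρ) (k n : ℕ) : 0 ≤ (1 / ρ) ^ k * ρ ^ n := by positivity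

section depoissonization

variable {a : ℕ → ℝ} {n : ℕ} {ρ A : ℝ}

/-- Where monotonicity gives a n ≤ a k the first term suffices; elsewhere the tilt is at least 1 and
the second does. Averaging over a Poisson number k of letters leaves only a multiplicative loss, so
`a` need not be bounded above. -/
lemma depoissonize_upper (h0 : 0 < ρ)
    (ha : ∀ k, a n ≤ a k + a n * ((1 / ρ) ^ k * ρ ^ n))
    (hA : HasSum (fun k : ℕ => (ρ * n) ^ k / k.factorial * a k) A) :
    a n * (1 - Real.exp (-(poissonGap ρ * n))) ≤ A * Real.exp (-(ρ * n)) := by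
  have h1 := (hasSum_pow_div_factorial (ρ * n)).mul_right (a n)
  have h2 := hA.add ((hasSum_tilted h0 n).mul_right (a n))
  have h3 := hasSum_le (fun k => ?_) h1 h2
  · have h4 := mul_le_mul_of_nonneg_right h3 (Real.exp_pos (-(ρ * n))).le
    have h5 : Real.exp (ρ * n) * Real.exp (-(ρ * n)) = 1 := by
      rw [← Real.exp_add, add_neg_cancel, Real.exp_zero]
    linear_combination h4 - (a n * (1 - Real.exp (-(poissonGap ρ * n)))) * h5
  · have h5 : 0 ≤ (ρ * n) ^ k / k.factorial := by positivity
    linear_combination mul_le_mul_of_nonneg_left (ha k) h5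

lemma depoissonize_upper_of_monotone (h1 : 1 < ρ) (ha : Monotone a) (hn : ∀ k, 0 ≤ a k)
    (hA : HasSum (fun k : ℕ => (ρ * n) ^ k / k.factorial * a k) A) :
    a n * (1 - Real.exp (-(poissonGap ρ * n))) ≤ A * Real.exp (-(ρ * n)) := by
  refine depoissonize_upper (by linarith) (fun k => ?_) hA
  rcases le_total n k with h | h
  · exact (ha h).trans (le_add_of_nonneg_right (mul_nonneg (hn _) (tilt_nonneg (by linarith) _ _)))
  · have := le_mul_of_one_le_right (hn n) (one_le_tilt_of_ge h1.le h)
    linarith [hn k]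

lemma depoissonize_upper_of_antitone (h0 : 0 < ρ) (h1 : ρ < 1) (ha : Antitone a)
    (hn : ∀ k, 0 ≤ a k) (hA : HasSum (fun k : ℕ => (ρ * n) ^ k / k.factorial * a k) A) :
    a n * (1 - Real.exp (-(poissonGap ρ * n))) ≤ A * Real.exp (-(ρ * n)) := by
  refine depoissonize_upper h0 (fun k => ?_) hA
  rcases le_total n k with h | h
  · have := le_mul_of_one_le_right (hn n) (one_le_tilt_of_le h0 h1.le h)
    linarith [hn k]
  · exact (ha h).trans (le_add_of_nonneg_right (mul_nonneg (hn _) (tilt_nonneg h0 _ _)))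

variable {c : ℕ → ℝ}

/-- The Poisson average is taken of a minorant `c`, which need not be monotone: later `c` is the
probability of an exact pair configuration and `a` that of a monotone event containing it. -/
lemma depoissonize_lower (h0 : 0 < ρ) (hc : ∀ k, c k ≤ a n + (1 / ρ) ^ k * ρ ^ n)
    (hA : HasSum (fun k : ℕ => (ρ * n) ^ k / k.factorial * c k) A) :
    A * Real.exp (-(ρ * n)) - Real.exp (-(poissonGap ρ * n)) ≤ a n := by
  have h1 := (hasSum_pow_div_factorial (ρ * n)).mul_right (a n)
  have h3 := hasSum_le (fun k => ?_) hA (h1.add (hasSum_tilted h0 n))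
  · have h4 := mul_le_mul_of_nonneg_right h3 (Real.exp_pos (-(ρ * n))).le
    have h5 : Real.exp (ρ * n) * Real.exp (-(ρ * n)) = 1 := by
      rw [← Real.exp_add, add_neg_cancel, Real.exp_zero]
    linear_combination h4 + (a n + Real.exp (-(poissonGap ρ * n))) * h5
  · have h5 : 0 ≤ (ρ * n) ^ k / k.factorial := by positivity
    linear_combination mul_le_mul_of_nonneg_left (hc k) h5

lemma depoissonize_lower_of_monotone (h0 : 0 < ρ) (h1 : ρ < 1) (ha : Monotone a)
    (hn : ∀ k, 0 ≤ a k) (ha1 : ∀ k, a k ≤ 1) (hc : ∀ k, c k ≤ a k)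
    (hA : HasSum (fun k : ℕ => (ρ * n) ^ k / k.factorial * c k) A) :
    A * Real.exp (-(ρ * n)) - Real.exp (-(poissonGap ρ * n)) ≤ a n := by
  refine depoissonize_lower h0 (fun k => (hc k).trans ?_) hA
  rcases le_total n k with h | h
  · linarith [ha1 k, one_le_tilt_of_le h0 h1.le h, hn n]
  · linarith [ha h, tilt_nonneg h0 k n]

lemma depoissonize_lower_of_antitone (h1 : 1 < ρ) (ha : Antitone a)
    (hn : ∀ k, 0 ≤ a k) (ha1 : ∀ k, a k ≤ 1) (hc : ∀ k, c k ≤ a k)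
    (hA : HasSum (fun k : ℕ => (ρ * n) ^ k / k.factorial * c k) A) :
    A * Real.exp (-(ρ * n)) - Real.exp (-(poissonGap ρ * n)) ≤ a n := by
  refine depoissonize_lower (by linarith) (fun k => (hc k).trans ?_) hA
  rcases le_total n k with h | h
  · linarith [ha h, tilt_nonneg (ρ := ρ) (by linarith) k n]
  · linarith [ha1 k, one_le_tilt_of_ge h1.le h, hn n]

end depoissonization

/-! ### Two elementary inequalities: symmetric functions and factorials -/

/-- Lower bound for elementary symmetric functions of numbers in `[0, Y]`. -/
lemma pow_div_factorial_le_esymm {ι : Type*} (s : Finset ι) (k : ℕ) {y : ι → ℝ} {Y : ℝ}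
    (h0 : ∀ i, 0 ≤ y i) (hY : ∀ i, y i ≤ Y) (hY0 : 0 ≤ Y) :
    (max 0 (∑ i ∈ s, y i - k * Y)) ^ k / k.factorial
      ≤ ∑ P ∈ s.powersetCard k, ∏ i ∈ P, y i := by
  classical
  induction s using Finset.induction_on generalizing k with
  | empty =>
    cases k with
    | zero => simp
    | succ k =>
      have : -(((k : ℝ) + 1) * Y) ≤ 0 := neg_nonpos.2 (by positivity)
      have h : Finset.powersetCard (k + 1) (∅ : Finset ι) = ∅ :=
        Finset.powersetCard_eq_empty.2 (by simp)
      simp [max_eq_left this, h]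
  | insert a s ha ih =>
    cases k with
    | zero => simp
    | succ k =>
      rw [Finset.powersetCard_succ_insert ha, Finset.sum_union, Finset.sum_image]
      · have h1 : ∑ P ∈ s.powersetCard k, ∏ i ∈ insert a P, y i
            = y a * ∑ P ∈ s.powersetCard k, ∏ i ∈ P, y i := by
          rw [Finset.mul_sum]
          refine Finset.sum_congr rfl fun P hP => Finset.prod_insert fun h => ha ?_
          exact (Finset.mem_powersetCard.1 hP).1 h
        rw [h1]
        refine le_trans ?_ (add_le_add (ih (k + 1)) (mul_le_mul_of_nonneg_left (ih k) (h0 a)))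
        rw [Finset.sum_insert ha]
        set S := ∑ i ∈ s, y i
        set u := max 0 (S - (k + 1 : ℕ) * Y)
        set w := max 0 (y a + S - (k + 1 : ℕ) * Y)
        set w' := max 0 (S - k * Y)
        have hu0 : 0 ≤ u := le_max_left _ _
        have hw0 : 0 ≤ w := le_max_left _ _
        have hw' : w ≤ w' := max_le_max le_rfl (by push_cast; linarith [hY a])
        have huw : w ≤ u + y a :=
          max_le (by linarith [h0 a]) (by linarith [le_max_right 0 (S - (k + 1 : ℕ) * Y)])
        have huw' : u ≤ w := max_le_max le_rfl (by linarith [h0 a])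
        -- Mean value inequality for the power, with w - u ≤ y a. The remaining factor w^k is at
        -- most w'^k because dropping y a ≤ Y is paid for by having one Y fewer to subtract.
        have key : w ^ (k + 1) - u ^ (k + 1) ≤ (k + 1) * y a * w ^ k := by
          have h2 : w ^ (k + 1) - u ^ (k + 1)
              = (∑ i ∈ Finset.range (k + 1), w ^ i * u ^ (k + 1 - 1 - i)) * (w - u) :=
            (Commute.all w u).geom_sum₂_mul (k + 1) |>.symm
          rw [h2]
          have h3 : ∑ i ∈ Finset.range (k + 1), w ^ i * u ^ (k + 1 - 1 - i) ≤ (k + 1) * w ^ k := by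
            have : ∀ i ∈ Finset.range (k + 1), w ^ i * u ^ (k + 1 - 1 - i) ≤ w ^ k := by
              intro i hi
              have hi' : i + (k - i) = k := by
                have := Finset.mem_range.1 hi; omega
              calc w ^ i * u ^ (k + 1 - 1 - i) ≤ w ^ i * w ^ (k - i) := by
                    simp only [Nat.add_sub_cancel]
                    gcongr
                _ = w ^ k := by rw [← pow_add, hi']
            refine (Finset.sum_le_card_nsmul _ _ _ this).trans ?_
            simp
          calc _ ≤ ((k + 1) * w ^ k) * y a :=
                mul_le_mul h3 (by linarith) (by linarith) (by positivity)
            _ = _ := by ring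
        have h4 : w ^ k ≤ w' ^ k := by gcongr
        have h5 : (0 : ℝ) < (k + 1).factorial := by positivity
        have h6 : ((k + 1).factorial : ℝ) = (k + 1) * k.factorial := by
          rw [Nat.factorial_succ]; push_cast; ring
        have h7 : y a * (w' ^ k / k.factorial) = (k + 1) * y a * w' ^ k / (k + 1).factorial := by
          rw [h6]; field_simp
        rw [h7, ← add_div]
        refine div_le_div_of_nonneg_right ?_ h5.le
        have := mul_le_mul_of_nonneg_left h4 (by have := h0 a; positivity : 0 ≤ (k + 1) * y a)
        linarith
      · intro P hP Q hQ h
        have haP : a ∉ P := fun h => ha ((Finset.mem_powersetCard.1 hP).1 h)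
        have haQ : a ∉ Q := fun h => ha ((Finset.mem_powersetCard.1 hQ).1 h)
        rw [← Finset.erase_insert haP, h, Finset.erase_insert haQ]
      · rw [Finset.disjoint_left]
        intro P hP hP'
        obtain ⟨Q, _, rfl⟩ := Finset.mem_image.1 hP'
        exact ha ((Finset.mem_powersetCard.1 hP).1 (Finset.mem_insert_self a Q))

/-- A crude Stirling bound, from e ≤ (1 + 1/k)^(k+1). The excess over (k/e)^k is only the factor ek,
which vanishes at exponential scale. -/
lemma factorial_le_pow_mul_exp {k : ℕ} (hk : 0 < k) :
    (k.factorial : ℝ) ≤ (k : ℝ) ^ (k + 1) * Real.exp (1 - k) := by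
  induction k, hk using Nat.le_induction with
  | base => simp
  | succ k hk ih =>
    have hk0 : (0 : ℝ) < k := by exact_mod_cast hk
    have h1 : Real.exp 1 * (k : ℝ) ^ (k + 1) ≤ ((k : ℝ) + 1) ^ (k + 1) := by
      have h2 : 1 / ((k : ℝ) + 1) ≤ Real.log (1 + 1 / k) := by
        have := Real.one_sub_inv_le_log_of_pos (x := 1 + 1 / (k : ℝ)) (by positivity)
        refine le_trans (le_of_eq ?_) this
        field_simp
        ring
      have h3 : Real.exp 1 ≤ (1 + 1 / (k : ℝ)) ^ (k + 1) := by
        rw [← Real.exp_log (x := (1 + 1 / (k : ℝ)) ^ (k + 1)) (by positivity), Real.log_pow]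
        refine Real.exp_le_exp.2 ?_
        calc (1 : ℝ) = ((k + 1 : ℕ) : ℝ) * (1 / ((k : ℝ) + 1)) := by push_cast; field_simp
          _ ≤ _ := by gcongr
      calc _ ≤ (1 + 1 / (k : ℝ)) ^ (k + 1) * (k : ℝ) ^ (k + 1) := by gcongr
        _ = _ := by rw [← mul_pow]; congr 1; field_simp
    rw [Nat.factorial_succ]
    push_cast
    calc ((k : ℝ) + 1) * k.factorial ≤ (k + 1) * ((k : ℝ) ^ (k + 1) * Real.exp (1 - k)) := by gcongr
      _ = (k + 1) * Real.exp (-k) * (Real.exp 1 * (k : ℝ) ^ (k + 1)) := by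
          rw [sub_eq_add_neg, Real.exp_add]; ring
      _ ≤ (k + 1) * Real.exp (-k) * ((k : ℝ) + 1) ^ (k + 1) := by gcongr
      _ = _ := by
          rw [show (1 : ℝ) - (k + 1) = -k by ring]; ring

/-! ### The statistic and its monotone envelopes -/

/-- The number of letters of a symbol that take part in a coincidence. -/
def coincFun (l : ℕ) : ℝ := if 2 ≤ l then (l : ℝ) else 0

/-- A monotone upper bound for the contribution of a symbol to the modified statistic. -/
def coincFunUp (V : ℝ) (l : ℕ) : ℝ := coincFun l + if 3 ≤ l then V else 0

/-- The contribution of a symbol to the modified statistic, shifted by the sample size. -/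
def modFun (L : ℕ) (v : ℕ → ℝ) (l : ℕ) : ℝ :=
  coincFun l + ∑ i ∈ Finset.Icc 2 L, v i * if l = i then (1 : ℝ) else 0

lemma coincFun_mono : Monotone coincFun := by
  intro a b h
  have : (a : ℝ) ≤ b := by exact_mod_cast h
  unfold coincFun
  split_ifs <;> first | omega | linarith

lemma coincFunUp_mono {V : ℝ} (hV : 0 ≤ V) : Monotone (coincFunUp V) := by
  intro a b h
  have := coincFun_mono h
  unfold coincFunUp
  split_ifs <;> first | omega | linarith

lemma coincFun_eq_sub (l : ℕ) : coincFun l = l - if l = 1 then (1 : ℝ) else 0 := by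
  unfold coincFun
  match l with
  | 0 => simp
  | 1 => simp
  | l + 2 => simp

lemma sum_symbCount_eq {n m : ℕ} (z : Fin n → Fin m) : ∑ j, symbCount z j = n := by
  have := Finset.card_eq_sum_card_fiberwise (s := (Finset.univ : Finset (Fin n)))
    (t := (Finset.univ : Finset (Fin m))) (f := z) fun _ _ => Finset.mem_coe.2 (Finset.mem_univ _)
  simpa [symbCount] using this.symm

/-- Counting singletons negatively is, up to the constant n, counting the letters that are not
alone; this exposes the monotone part of the statistic. -/
lemma modStat_eq (L : ℕ) (v : ℕ → ℝ) {n m : ℕ} (z : Fin n → Fin m) :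
    modStat L v z = ∑ j, modFun L v (symbCount z j) - n := by
  have h : (n : ℝ) = ∑ j, (symbCount z j : ℝ) := by exact_mod_cast (sum_symbCount_eq z).symm
  simp only [modStat, coincStat, modFun, coincFun_eq_sub, Finset.sum_add_distrib,
    Finset.sum_sub_distrib]
  rw [h]
  ring

lemma coincFun_le_modFun {L : ℕ} {v : ℕ → ℝ} (hv2 : v 2 = 0) (hv : ∀ l, 3 ≤ l → l ≤ L → 0 ≤ v l)
    (l : ℕ) : coincFun l ≤ modFun L v l := by
  refine le_add_of_nonneg_right (Finset.sum_nonneg fun i hi => mul_nonneg ?_ ?_)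
  · rw [Finset.mem_Icc] at hi
    rcases hi.1.eq_or_lt with h | h
    · rw [← h, hv2]
    · exact hv i h hi.2
  · split_ifs <;> norm_num

/-- The bonuses v_l may drop as l grows, so `modFun` need not be monotone; their sum V bounds each
of them. Since v_2 = 0, the envelope loses nothing on pairs. -/
lemma modFun_le_coincFunUp {L : ℕ} {v : ℕ → ℝ} (hv2 : v 2 = 0)
    (hv : ∀ l, 3 ≤ l → l ≤ L → 0 ≤ v l) (l : ℕ) :
    modFun L v l ≤ coincFunUp (∑ i ∈ Finset.Icc 3 L, v i) l := by
  refine add_le_add_right ?_ _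
  have hnn : ∀ i ∈ Finset.Icc 3 L, 0 ≤ v i := fun i hi =>
    hv i (Finset.mem_Icc.1 hi).1 (Finset.mem_Icc.1 hi).2
  have h1 : ∑ i ∈ Finset.Icc 2 L, v i * (if l = i then (1 : ℝ) else 0)
      = if l ∈ Finset.Icc 2 L then v l else 0 := by
    simp
  rw [h1]
  split_ifs with h2 h3 h3
  · exact Finset.single_le_sum hnn (Finset.mem_Icc.2 ⟨h3, (Finset.mem_Icc.1 h2).2⟩)
  · have : l = 2 := by have := (Finset.mem_Icc.1 h2).1; omega
    rw [this, hv2]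
  · exact Finset.sum_nonneg hnn
  · exact le_rfl

/-! ### The mean of the statistic under uniformity -/

lemma coincFun_le_choose (l : ℕ) : coincFun l ≤ 2 * (l.choose 2 : ℝ) := by
  rw [Nat.cast_choose_two]
  unfold coincFun
  match l with
  | 0 => simp
  | 1 => simp
  | l + 2 =>
    simp only [le_add_iff_nonneg_left, zero_le, if_true]
    push_cast
    nlinarith [Nat.cast_nonneg (α := ℝ) l]

lemma choose_le_coincFun (l : ℕ) :
    2 * (l.choose 2 : ℝ) - 6 * (l.choose 3 : ℝ) ≤ coincFun l := by
  have h3 : ((l.choose 3 : ℕ) : ℝ) * 3 = l.choose 2 * ((l : ℝ) - 2) := by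
    rcases le_or_gt 2 l with h | h
    · have := Nat.choose_succ_right_eq l 2
      have h2 : ((l - 2 : ℕ) : ℝ) = (l : ℝ) - 2 := by push_cast [h]; ring
      rw [← h2]
      exact_mod_cast this
    · rw [Nat.choose_eq_zero_of_lt (show l < 3 by omega), Nat.choose_eq_zero_of_lt h]
      simp
  have h2 : (l.choose 2 : ℝ) = l * (l - 1) / 2 := Nat.cast_choose_two ℝ l
  unfold coincFun
  match l with
  | 0 => simp
  | 1 => simp
  | 2 => norm_num [Nat.choose]
  | l + 3 =>
    have h0 : (0 : ℝ) ≤ l := Nat.cast_nonneg l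
    have hc : (0 : ℝ) ≤ ((l + 3).choose 2 : ℝ) := Nat.cast_nonneg _
    rw [if_pos (by omega)]
    push_cast at *
    nlinarith

lemma coincFunUp_le_choose {V : ℝ} (hV : 0 ≤ V) (l : ℕ) :
    coincFunUp V l ≤ 2 * (l.choose 2 : ℝ) + V * (l.choose 3 : ℝ) := by
  refine add_le_add (coincFun_le_choose l) ?_
  split_ifs with h
  · have : (1 : ℝ) ≤ (l.choose 3 : ℝ) := by exact_mod_cast Nat.choose_pos h
    nlinarith
  · positivity

/-- Binomial moments of a symbol count. -/
lemma countExpect_choose {m n : ℕ} (hm : 0 < m) (j : Fin m) (k : ℕ) :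
    countExpect (unif m) n (fun N => ((N j).choose k : ℝ)) = n.choose k * (1 / (m : ℝ)) ^ k := by
  classical
  -- The probability generating function of the count, in powers of 1 + X so that the coefficients
  -- are binomial moments, expanded as an n-th power and as a sum over samples.
  have h := Finset.sum_pow' (Finset.univ : Finset (Fin m))
    (fun a => Polynomial.C (1 / (m : ℝ)) * (if a = j then 1 + Polynomial.X else 1)) n
  rw [Fintype.piFinset_univ] at h
  have h1 : ∑ a, Polynomial.C (1 / (m : ℝ)) * (if a = j then 1 + Polynomial.X else 1)
      = (1 + Polynomial.X : Polynomial ℝ).comp (Polynomial.C (1 / (m : ℝ)) * Polynomial.X) := by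
    have : ∀ a : Fin m, Polynomial.C (1 / (m : ℝ)) * (if a = j then 1 + Polynomial.X else 1)
        = Polynomial.C (1 / (m : ℝ))
          + if a = j then Polynomial.C (1 / (m : ℝ)) * Polynomial.X else 0 := by
      intro a; split_ifs <;> ring
    simp_rw [this]
    rw [Finset.sum_add_distrib, Finset.sum_ite_eq' Finset.univ j, Finset.sum_const]
    have hm' : (m : ℝ) ≠ 0 := by positivity
    have h2 : (m : Polynomial ℝ) * Polynomial.C (1 / (m : ℝ)) = 1 := by
      rw [← Polynomial.C_eq_natCast, ← Polynomial.C_mul, mul_one_div_cancel hm', Polynomial.C_1]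
    simp only [Finset.card_univ, Fintype.card_fin, nsmul_eq_mul, Finset.mem_univ, if_true, h2,
      Polynomial.add_comp, Polynomial.one_comp, Polynomial.X_comp]
  have h2 := congrArg (fun p : Polynomial ℝ => p.coeff k) h
  rw [h1, ← Polynomial.pow_comp, Polynomial.comp_C_mul_X_coeff, Polynomial.coeff_one_add_X_pow,
    Polynomial.finsetSum_coeff] at h2
  rw [h2]
  simp only [countExpect, iidExpect]
  refine Finset.sum_congr rfl fun z _ => ?_
  rw [Finset.prod_mul_distrib,
    ← Finset.prod_filter_mul_prod_filter_not Finset.univ (fun i => z i = j)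
    (fun i => if z i = j then (1 + Polynomial.X : Polynomial ℝ) else 1)]
  rw [Finset.prod_congr rfl (g := fun _ => (1 + Polynomial.X : Polynomial ℝ))
    (s₁ := Finset.univ.filter fun i => z i = j) (by intro i hi; simp [(Finset.mem_filter.1 hi).2]),
    Finset.prod_congr rfl (g := fun _ => (1 : Polynomial ℝ))
    (s₁ := Finset.univ.filter fun i => ¬ z i = j)
    (by intro i hi; simp [(Finset.mem_filter.1 hi).2])]
  rw [Finset.prod_const_one, mul_one, ← map_prod, Polynomial.coeff_C_mul, Finset.prod_const,
    Finset.prod_const,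
    show (Finset.univ.filter fun i => z i = j).card = symbCount z j from by
      unfold symbCount; congr!, Polynomial.coeff_one_add_X_pow]
  simp only [iidWeight, unif, Finset.prod_const]

lemma unif_mem {m : ℕ} (hm : 0 < m) : unif m ∈ stdSimplex ℝ (Fin m) := by
  have hm' : (m : ℝ) ≠ 0 := by positivity
  refine ⟨fun _ => by unfold unif; positivity, ?_⟩
  simp [unif, hm']

/-- The mean of the modified statistic under the uniform p.m.f., shifted by the sample size. -/
def modMean (L : ℕ) (v : ℕ → ℝ) (n m : ℕ) : ℝ :=
  n + iidExpect (unif m) (modStat L v : (Fin n → Fin m) → ℝ)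

lemma modMean_eq (L : ℕ) (v : ℕ → ℝ) {n m : ℕ} (hm : 0 < m) :
    modMean L v n m = ∑ j, countExpect (unif m) n fun N => modFun L v (N j) := by
  rw [← countExpect_sum]
  have h1 : iidExpect (unif m) (modStat L v : (Fin n → Fin m) → ℝ)
      = countExpect (unif m) n (fun N => ∑ j, modFun L v (N j)) - n := by
    have h2 : (n : ℝ) = ∑ z : Fin n → Fin m, iidWeight (unif m) z * n := by
      rw [← Finset.sum_mul, sum_iidWeight (unif_mem hm).2, one_mul]
    conv_rhs => rw [h2]
    simp only [countExpect, iidExpect, modStat_eq, mul_sub, Finset.sum_sub_distrib]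
  rw [modMean, h1]
  ring

lemma sum_countExpect_choose {m n : ℕ} (hm : 0 < m) (a b : ℝ) :
    ∑ j, countExpect (unif m) n (fun N => a * ((N j).choose 2 : ℝ) + b * ((N j).choose 3 : ℝ))
      = m * (a * (n.choose 2 * (1 / (m : ℝ)) ^ 2) + b * (n.choose 3 * (1 / (m : ℝ)) ^ 3)) := by
  have : ∀ j : Fin m,
      countExpect (unif m) n (fun N => a * ((N j).choose 2 : ℝ) + b * ((N j).choose 3 : ℝ))
      = a * (n.choose 2 * (1 / (m : ℝ)) ^ 2) + b * (n.choose 3 * (1 / (m : ℝ)) ^ 3) := by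
    intro j
    rw [← countExpect_choose hm j 2, ← countExpect_choose hm j 3, ← countExpect_const_mul,
      ← countExpect_const_mul]
    simp only [countExpect, iidExpect, mul_add, Finset.sum_add_distrib]
  simp only [this, Finset.sum_const, Finset.card_univ, Fintype.card_fin, nsmul_eq_mul]

lemma le_modMean {L : ℕ} {v : ℕ → ℝ} (hv2 : v 2 = 0) (hv : ∀ l, 3 ≤ l → l ≤ L → 0 ≤ v l)
    {n m : ℕ} (hm : 0 < m) (hn : 0 < n) :
    (n : ℝ) ^ 2 / m * (1 - 1 / n - n / m) ≤ modMean L v n m := by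
  rw [modMean_eq L v hm]
  have h := Finset.sum_le_sum (s := Finset.univ) fun j (_ : j ∈ (Finset.univ : Finset (Fin m))) =>
    countExpect_mono (n := n) (unif_mem hm).1
      (F := fun N => 2 * ((N j).choose 2 : ℝ) + (-6) * ((N j).choose 3 : ℝ))
      (G := fun N => modFun L v (N j)) fun N => by
        have := choose_le_coincFun (N j)
        have := coincFun_le_modFun hv2 hv (N j)
        linarith
  refine le_trans ?_ h
  rw [sum_countExpect_choose hm]
  have h2 : (n.choose 2 : ℝ) = n * (n - 1) / 2 := Nat.cast_choose_two ℝ n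
  have h3 : (n.choose 3 : ℝ) ≤ n ^ 3 / 6 := by
    have := Nat.choose_le_pow_div (α := ℝ) 3 n
    norm_num [Nat.factorial] at this
    exact this
  have hm0 : (0 : ℝ) < m := by exact_mod_cast hm
  have hn0 : (0 : ℝ) < n := by exact_mod_cast hn
  rw [h2]
  calc (n : ℝ) ^ 2 / m * (1 - 1 / n - n / m)
      = m * (2 * (n * (n - 1) / 2 * (1 / (m : ℝ)) ^ 2)
        + -6 * (n ^ 3 / 6 * (1 / (m : ℝ)) ^ 3)) := by field_simp; ring
    _ ≤ _ := by
      have : (n.choose 3 : ℝ) * (1 / (m : ℝ)) ^ 3 ≤ n ^ 3 / 6 * (1 / (m : ℝ)) ^ 3 := by gcongr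
      refine mul_le_mul_of_nonneg_left ?_ hm0.le
      linarith

lemma modMean_le {L : ℕ} {v : ℕ → ℝ} (hv2 : v 2 = 0) (hv : ∀ l, 3 ≤ l → l ≤ L → 0 ≤ v l)
    {n m : ℕ} (hm : 0 < m) :
    modMean L v n m ≤ (n : ℝ) ^ 2 / m * (1 + (∑ i ∈ Finset.Icc 3 L, v i) * (n / m)) := by
  rw [modMean_eq L v hm]
  set V := ∑ i ∈ Finset.Icc 3 L, v i
  have hV : 0 ≤ V := Finset.sum_nonneg fun i hi =>
    hv i (Finset.mem_Icc.1 hi).1 (Finset.mem_Icc.1 hi).2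
  have h := Finset.sum_le_sum (s := Finset.univ) fun j (_ : j ∈ (Finset.univ : Finset (Fin m))) =>
    countExpect_mono (n := n) (unif_mem hm).1 (F := fun N => modFun L v (N j))
      (G := fun N => 2 * ((N j).choose 2 : ℝ) + V * ((N j).choose 3 : ℝ)) fun N =>
        (modFun_le_coincFunUp hv2 hv (N j)).trans (coincFunUp_le_choose hV (N j))
  refine h.trans ?_
  rw [sum_countExpect_choose hm]
  have h2 : (n.choose 2 : ℝ) ≤ n ^ 2 / 2 := by
    have := Nat.choose_le_pow_div (α := ℝ) 2 n
    norm_num [Nat.factorial] at this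
    exact this
  have h3 : (n.choose 3 : ℝ) ≤ n ^ 3 := by
    have := Nat.choose_le_pow_div (α := ℝ) 3 n
    norm_num [Nat.factorial] at this
    refine this.trans (div_le_self (by positivity) (by norm_num))
  have hm0 : (0 : ℝ) < m := by exact_mod_cast hm
  calc _ ≤ m * (2 * ((n : ℝ) ^ 2 / 2 * (1 / (m : ℝ)) ^ 2) + V * (n ^ 3 * (1 / (m : ℝ)) ^ 3)) := by
        gcongr
    _ = _ := by field_simp

/-! ### Limits of the normalization, the mean and the threshold -/

section asymptotics

variable {m : ℕ → ℕ}

lemma tendsto_div_alphabet (hm : ∀ n, 0 < m n)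
    (hnm : (fun n : ℕ => (n : ℝ)) =o[atTop] fun n => (m n : ℝ)) :
    Tendsto (fun n : ℕ => (n : ℝ) / m n) atTop (𝓝 0) :=
  (isLittleO_iff_tendsto fun n h => by
    have : (m n : ℝ) ≠ 0 := by exact_mod_cast (hm n).ne'
    exact absurd h this).1 hnm

lemma tendsto_normalization (hm : ∀ n, 0 < m n)
    (hmn : (fun n : ℕ => (m n : ℝ)) =o[atTop] fun n => (n : ℝ) ^ 2) :
    Tendsto (fun n : ℕ => (n : ℝ) ^ 2 / m n) atTop atTop := by
  have h0 : ∀ᶠ n : ℕ in atTop, (0 : ℝ) < m n / (n : ℝ) ^ 2 := by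
    filter_upwards [eventually_gt_atTop 0] with n hn
    have : (0 : ℝ) < m n := by exact_mod_cast hm n
    positivity
  have h1 : Tendsto (fun n : ℕ => (m n : ℝ) / (n : ℝ) ^ 2) atTop (𝓝[>] 0) :=
    tendsto_nhdsWithin_iff.2 ⟨hmn.tendsto_div_nhds_zero, h0⟩
  refine h1.inv_tendsto_nhdsGT_zero.congr fun n => ?_
  simp

/-- Pairs contribute n²/m, while triples and the bonuses attached to them contribute at most order
n³/m², smaller by the vanishing factor n/m. -/
lemma tendsto_modMean {L : ℕ} {v : ℕ → ℝ} (hv2 : v 2 = 0) (hv : ∀ l, 3 ≤ l → l ≤ L → 0 ≤ v l)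
    (hm : ∀ n, 0 < m n) (hnm : (fun n : ℕ => (n : ℝ)) =o[atTop] fun n => (m n : ℝ)) :
    Tendsto (fun n : ℕ => modMean L v n (m n) / ((n : ℝ) ^ 2 / m n)) atTop (𝓝 1) := by
  have hx := tendsto_div_alphabet hm hnm
  have h1 : Tendsto (fun n : ℕ => 1 - 1 / (n : ℝ) - n / m n) atTop (𝓝 1) := by
    simpa using (tendsto_one_div_atTop_nhds_zero_nat.const_sub (1 : ℝ)).sub hx
  have h2 : Tendsto (fun n : ℕ => 1 + (∑ i ∈ Finset.Icc 3 L, v i) * ((n : ℝ) / m n)) atTop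
      (𝓝 1) := by
    simpa using (hx.const_mul (∑ i ∈ Finset.Icc 3 L, v i)).const_add 1
  refine tendsto_of_tendsto_of_tendsto_of_le_of_le' h1 h2 ?_ ?_
  all_goals
    filter_upwards [eventually_gt_atTop 0] with n hn
    have h3 : (0 : ℝ) < m n := by exact_mod_cast hm n
    have h4 : (0 : ℝ) < n := by exact_mod_cast hn
  · rw [le_div_iff₀' (by positivity)]
    exact le_modMean hv2 hv (hm n) hn
  · rw [div_le_iff₀' (by positivity)]
    exact modMean_le hv2 hv (hm n)

lemma tendsto_threshold {L : ℕ} {v : ℕ → ℝ} (hv2 : v 2 = 0)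
    (hv : ∀ l, 3 ≤ l → l ≤ L → 0 ≤ v l)
    (hm : ∀ n, 0 < m n) (hnm : (fun n : ℕ => (n : ℝ)) =o[atTop] fun n => (m n : ℝ))
    {t : ℕ → ℝ} {τ : ℝ}
    (ht : Tendsto (fun n : ℕ => (m n : ℝ) * t n / (n : ℝ) ^ 2) atTop (𝓝 τ)) :
    Tendsto (fun n : ℕ => (t n + modMean L v n (m n)) / ((n : ℝ) ^ 2 / m n)) atTop
      (𝓝 (1 + τ)) := by
  refine ((tendsto_modMean hv2 hv hm hnm).add ht).congr fun n => ?_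
  rw [add_div, add_comm]
  congr 1
  rw [div_div_eq_mul_div, mul_comm]

end asymptotics

/-! ### Bounding decision probabilities by expectations of functions of the counts -/

lemma modTest_eq_true_iff (L : ℕ) (v : ℕ → ℝ) (n m : ℕ) (t : ℝ) (z : Fin n → Fin m) :
    modTest L v n m t z = true ↔ t + modMean L v n m ≤ ∑ j, modFun L v (symbCount z j) := by
  rw [modTest, decide_eq_true_iff, modStat_eq, modMean]
  constructor <;> intro h <;> linarith

lemma modTest_eq_false_iff (L : ℕ) (v : ℕ → ℝ) (n m : ℕ) (t : ℝ) (z : Fin n → Fin m) :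
    modTest L v n m t z = false ↔ ∑ j, modFun L v (symbCount z j) < t + modMean L v n m := by
  rw [← not_le, ← modTest_eq_true_iff, Bool.not_eq_true]

lemma decisionProb_le_countExpect {n m : ℕ} {q : Fin m → ℝ} (hq : ∀ j, 0 ≤ q j)
    {φ : (Fin n → Fin m) → Bool} {b : Bool} {F : (Fin m → ℕ) → ℝ} (hF : ∀ N, 0 ≤ F N)
    (h : ∀ z, φ z = b → 1 ≤ F (symbCount z)) : decisionProb q φ b ≤ countExpect q n F := by
  rw [decisionProb, countExpect, iidExpect, Finset.sum_filter]
  refine Finset.sum_le_sum fun z _ => ?_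
  split_ifs with hz
  · exact le_mul_of_one_le_right (iidWeight_nonneg hq z) (h z hz)
  · exact mul_nonneg (iidWeight_nonneg hq z) (hF _)

lemma countExpect_le_decisionProb {n m : ℕ} {q : Fin m → ℝ} (hq : ∀ j, 0 ≤ q j)
    {φ : (Fin n → Fin m) → Bool} {b : Bool} {F : (Fin m → ℕ) → ℝ} (hF : ∀ N, F N ≤ 1)
    (h : ∀ z, φ z ≠ b → F (symbCount z) ≤ 0) : countExpect q n F ≤ decisionProb q φ b := by
  rw [decisionProb, countExpect, iidExpect, Finset.sum_filter]
  refine Finset.sum_le_sum fun z _ => ?_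
  split_ifs with hz
  · exact mul_le_of_le_one_right (iidWeight_nonneg hq z) (hF _)
  · exact mul_nonpos_of_nonneg_of_nonpos (iidWeight_nonneg hq z) (h z hz)

/-! ### One-symbol generating functions of the tilted counts -/

/-- Exponential generating function of the tilted weights `exp (θ f(l))` for
`f = coincFunUp V`. -/
def tiltedGen (θ V x : ℝ) : ℝ :=
  Real.exp (θ * V) * (Real.exp (Real.exp θ * x) - 1 - Real.exp θ * x - (Real.exp θ * x) ^ 2 / 2)
    + (1 + x + (Real.exp θ * x) ^ 2 / 2)

lemma hasSum_tiltedGen (θ V x : ℝ) :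
    HasSum (fun l : ℕ => Real.exp (θ * coincFunUp V l) * x ^ l / l.factorial)
      (tiltedGen θ V x) := by
  have h := (hasSum_nat_add_iff' 3).2 (hasSum_pow_div_factorial (Real.exp θ * x))
  have h2 := h.mul_left (Real.exp (θ * V))
  have h3 : HasSum (fun l : ℕ => Real.exp (θ * coincFunUp V (l + 3)) * x ^ (l + 3) /
      (l + 3).factorial) _ := h2.congr_fun fun l => by
    have : Real.exp (θ * coincFunUp V (l + 3)) = Real.exp (θ * V) * Real.exp θ ^ (l + 3) := by
      rw [← Real.exp_nat_mul, ← Real.exp_add, coincFunUp, coincFun, if_pos (by omega),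
        if_pos (by omega)]
      congr 1; ring
    rw [this, mul_pow]; ring
  have h4 := (hasSum_nat_add_iff (f := fun l : ℕ => Real.exp (θ * coincFunUp V l) * x ^ l /
    l.factorial) 3).1 h3
  have e2 : Real.exp (θ * 2) = Real.exp θ ^ 2 := by
    rw [← Real.exp_nat_mul]; congr 1; push_cast; ring
  have h5 : tiltedGen θ V x = Real.exp (θ * V) * (Real.exp (Real.exp θ * x)
      - ∑ i ∈ Finset.range 3, (Real.exp θ * x) ^ i / i.factorial)
      + ∑ i ∈ Finset.range 3, Real.exp (θ * coincFunUp V i) * x ^ i / i.factorial := by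
    simp [Finset.sum_range_succ, coincFunUp, coincFun, e2, tiltedGen]
    ring
  rw [h5]
  exact h4

lemma exp_le_cubic {y : ℝ} (hy : 0 ≤ y) :
    Real.exp y - 1 - y - y ^ 2 / 2 ≤ y ^ 3 * Real.exp y := by
  have h := (hasSum_nat_add_iff' 3).2 (hasSum_pow_div_factorial y)
  have h2 := hasSum_le (fun l => ?_) h ((hasSum_pow_div_factorial y).mul_left (y ^ 3))
  · simp [Finset.sum_range_succ] at h2
    linarith
  · rw [pow_add, mul_comm, mul_div_assoc]
    have : (l.factorial : ℝ) ≤ (l + 3).factorial := by exact_mod_cast Nat.factorial_le (by omega)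
    gcongr

/-- Only the coefficient of x² distinguishes the tilted series from exp x up to order two. The
bonuses enter from x³ on, so they affect only the constant of a term negligible after summing over
the symbols. -/
lemma tiltedGen_le {θ V x : ℝ} (hθ : 0 ≤ θ) (hx : 0 ≤ x) (hx1 : x ≤ 1) :
    tiltedGen θ V x ≤ Real.exp (x + ((Real.exp (2 * θ) - 1) / 2 * x ^ 2
      + Real.exp (θ * V) * Real.exp θ ^ 3 * Real.exp (Real.exp θ) * x ^ 3)) := by
  set s := Real.exp θ
  have hs : 1 ≤ s := Real.one_le_exp hθ
  have hs2 : Real.exp (2 * θ) = s ^ 2 := by rw [← Real.exp_nat_mul]; norm_cast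
  have h1 := exp_le_cubic (y := s * x) (by positivity)
  have h2 : Real.exp (s * x) ≤ Real.exp s := Real.exp_le_exp.2 (by nlinarith)
  have h3 : 1 + x + x ^ 2 / 2 ≤ Real.exp x := Real.quadratic_le_exp_of_nonneg hx
  rw [hs2]
  set K := Real.exp (θ * V) * s ^ 3 * Real.exp s
  have hu : 0 ≤ (s ^ 2 - 1) / 2 * x ^ 2 + K * x ^ 3 := by
    have : 0 ≤ s ^ 2 - 1 := by nlinarith
    positivity
  calc tiltedGen θ V x
      ≤ Real.exp (θ * V) * ((s * x) ^ 3 * Real.exp s) + (1 + x + (s * x) ^ 2 / 2) := by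
        unfold tiltedGen
        gcongr
        refine h1.trans ?_
        gcongr
    _ = (1 + x + x ^ 2 / 2) + ((s ^ 2 - 1) / 2 * x ^ 2 + K * x ^ 3) := by ring
    _ ≤ Real.exp x * 1 + Real.exp x * ((s ^ 2 - 1) / 2 * x ^ 2 + K * x ^ 3) := by
        rw [mul_one]
        exact add_le_add h3 (le_mul_of_one_le_left hu (Real.one_le_exp hx))
    _ = Real.exp x * (((s ^ 2 - 1) / 2 * x ^ 2 + K * x ^ 3) + 1) := by ring
    _ ≤ _ := by
        rw [Real.exp_add x]
        exact mul_le_mul_of_nonneg_left (Real.add_one_le_exp _) (Real.exp_pos x).le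

lemma tiltedGen_zero (θ x : ℝ) :
    tiltedGen θ 0 x = Real.exp (Real.exp θ * x) + (1 - Real.exp θ) * x := by
  simp [tiltedGen]; ring

/-- Both sides agree through order two; from order three on the coefficients carry s^l ≤ 1. -/
lemma exp_gap {s x : ℝ} (h0 : 0 ≤ s) (h1 : s ≤ 1) (hx : 0 ≤ x) :
    Real.exp (s * x) + (1 - s) * x ≤ Real.exp x - (1 - s ^ 2) / 2 * x ^ 2 := by
  have h := (hasSum_nat_add_iff' 3).2 (hasSum_pow_div_factorial (s * x))
  have h2 := hasSum_le (fun l => ?_) h ((hasSum_nat_add_iff' 3).2 (hasSum_pow_div_factorial x))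
  · simp [Finset.sum_range_succ] at h2
    nlinarith
  · have : s * x ≤ x := mul_le_of_le_one_left hx h1
    gcongr

/-- A quadratic lower bound, in tangent form, for the logarithm of the Poisson tilted
expectation. -/
lemma exists_tangent_bound {s δ : ℝ} (h0 : 0 < s) (h1 : s ≤ 1) (hδ0 : 0 < δ) (hδ1 : δ < 1) :
    ∃ a₀ > 0, ∀ a ≤ a₀, ∀ x ≥ 0, Real.exp (s * x) + (1 - s) * x
      ≤ Real.exp (x - (1 - δ) * ((1 - s ^ 2) / 2) * (2 * a * x - a ^ 2)) := by
  -- Chosen so that exp(-x) ≥ 1 - δ for x ≤ η. There the quadratic gain survives up to the factor 1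
  -- - δ and lies above all its tangents. For x ≥ η the gain is only linear in x, and beating a
  -- tangent requires its slope parameter to stay below a₀.
  set η := -Real.log (1 - δ)
  have hη : 0 < η := neg_pos.2 (Real.log_neg (by linarith) (by linarith))
  have hc : 0 ≤ (1 - s ^ 2) / 2 := by nlinarith
  have hc1 : (1 - s ^ 2) / 2 ≤ 1 - s := by nlinarith
  have hgap : 0 < 1 - Real.exp (-(s * η)) := by
    have : Real.exp (-(s * η)) < 1 := (Real.exp_lt_one_iff).2 (neg_lt_zero.2 (by positivity))
    linarith
  refine ⟨(1 - Real.exp (-(s * η))) / 2, by positivity, fun a ha x hx => ?_⟩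
  rcases le_total x η with hxη | hxη
  · have h2 : 1 - δ ≤ Real.exp (-x) := by
      rw [← Real.exp_log (show 0 < 1 - δ by linarith)]
      exact Real.exp_le_exp.2 (by simp only [η] at hxη; linarith)
    have h3 : Real.exp x * Real.exp (-x) = 1 := by rw [← Real.exp_add]; simp
    have h4 : 0 ≤ (1 - s ^ 2) / 2 * x ^ 2 := by positivity
    calc _ ≤ Real.exp x - (1 - s ^ 2) / 2 * x ^ 2 := exp_gap h0.le h1 hx
      _ = Real.exp x * (1 - Real.exp (-x) * ((1 - s ^ 2) / 2 * x ^ 2)) := by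
          rw [mul_sub, ← mul_assoc, h3]; ring
      _ ≤ Real.exp x * (1 - (1 - δ) * ((1 - s ^ 2) / 2 * x ^ 2)) := by gcongr
      _ ≤ Real.exp x * Real.exp (-((1 - δ) * ((1 - s ^ 2) / 2 * x ^ 2))) := by
          gcongr
          exact Real.one_sub_le_exp_neg _
      _ ≤ _ := by
          rw [← Real.exp_add]
          refine Real.exp_le_exp.2 ?_
          have h5 : 0 ≤ (1 - δ) * ((1 - s ^ 2) / 2) := mul_nonneg (by linarith) hc
          nlinarith [mul_nonneg h5 (sq_nonneg (x - a))]
  · have h2 : Real.exp (-(s * x)) ≤ Real.exp (-(s * η)) := Real.exp_le_exp.2 (by nlinarith)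
    have h3 : Real.exp (s * x) * Real.exp (-(s * x)) = 1 := by rw [← Real.exp_add]; simp
    have h4 : 0 ≤ (1 - s) * x := mul_nonneg (by linarith) hx
    calc Real.exp (s * x) + (1 - s) * x
        = Real.exp (s * x) * ((1 - s) * x * Real.exp (-(s * x)) + 1) := by
          linear_combination (-(1 - s) * x) * h3
      _ ≤ Real.exp (s * x) * Real.exp ((1 - s) * x * Real.exp (-(s * η))) := by
          gcongr
          refine le_trans ?_ (Real.add_one_le_exp _)
          gcongr
      _ ≤ _ := by
          rw [← Real.exp_add]
          refine Real.exp_le_exp.2 ?_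
          have h5 : (1 - δ) * ((1 - s ^ 2) / 2) * (2 * a * x - a ^ 2)
              ≤ (1 - s) * x * (1 - Real.exp (-(s * η))) := by
            have h6 : 0 ≤ (1 - δ) * ((1 - s ^ 2) / 2) := mul_nonneg (by linarith) hc
            have h7 : (1 - δ) * ((1 - s ^ 2) / 2) ≤ 1 - s := by nlinarith
            calc _ ≤ (1 - δ) * ((1 - s ^ 2) / 2) * (x * (1 - Real.exp (-(s * η)))) := by
                  refine mul_le_mul_of_nonneg_left ?_ h6
                  nlinarith [sq_nonneg a]
              _ ≤ (1 - s) * (x * (1 - Real.exp (-(s * η)))) :=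
                  mul_le_mul_of_nonneg_right h7 (by positivity)
              _ = _ := by ring
          nlinarith

/-! ### Duality for the quadratic functional on the alternative -/

/-- The dual certificate for the minimum of `∑ q²` at given distance from uniformity. -/
lemma exists_dual {ε : ℝ} (hε0 : 0 < ε) (hε1 : ε < 1) : ∃ A : ℝ, 0 < A ∧
    ∀ (m : ℕ) (q : Fin m → ℝ), 0 < m → q ∈ altSet ε m → ∃ a : Fin m → ℝ, (∀ j, a j ≤ A) ∧
      m * kappa ε ≤ 2 * m * ∑ j, a j * q j - ∑ j, a j ^ 2 := by
  classical
  -- W is the largest value of β(1 - β) on [0, 1 - ε], where β is the uniform mass of a set B that q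
  -- overweights by ε. The maximum is at 1/2 or at the endpoint 1 - ε, whence the two regimes of κ.
  obtain ⟨W, hW0, hWk, hWb⟩ : ∃ W : ℝ, 0 < W ∧ kappa ε = 1 + ε ^ 2 / W ∧
      ∀ β, 0 ≤ β → β ≤ 1 - ε → β * (1 - β) ≤ W := by
    unfold kappa
    split_ifs with h
    · exact ⟨1 / 4, by norm_num, by ring, fun β _ _ => by nlinarith [sq_nonneg (β - 1 / 2)]⟩
    · push Not at h
      have : 0 < 1 - ε := by linarith
      refine ⟨ε * (1 - ε), by positivity, by field_simp, fun β h0 h1 => ?_⟩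
      nlinarith
  set k := ε / W
  have hk : 0 < k := by positivity
  refine ⟨1 + k, by positivity, fun m q hm ⟨hq, htv⟩ => ?_⟩
  have hm0 : (0 : ℝ) < m := by exact_mod_cast hm
  have hB : ∃ B : Finset (Fin m), (B.card : ℝ) / m + ε ≤ ∑ j ∈ B, q j := by
    obtain ⟨B, hB⟩ := exists_eq_ciSup_of_finite
      (f := fun B : Finset (Fin m) => |∑ j ∈ B, q j - ∑ j ∈ B, unif m j|)
    rw [tvDist, ← hB] at htv
    have hu : ∀ B : Finset (Fin m), ∑ j ∈ B, unif m j = (B.card : ℝ) / m := by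
      intro B
      simp only [unif, Finset.sum_const, nsmul_eq_mul, mul_one_div]
    rw [hu] at htv
    rcases le_abs.1 htv with h | h
    · exact ⟨B, by linarith⟩
    · refine ⟨Bᶜ, ?_⟩
      have h1 := Finset.sum_add_sum_compl B q
      have h2 := Finset.sum_add_sum_compl B (unif m)
      rw [hq.2] at h1
      rw [(unif_mem hm).2, hu, hu] at h2
      linarith
  obtain ⟨B, hB⟩ := hB
  set β := (B.card : ℝ) / m
  have hβ0 : 0 ≤ β := by positivity
  have hqB : ∑ j ∈ B, q j ≤ 1 := by
    rw [← hq.2]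
    exact Finset.sum_le_univ_sum_of_nonneg hq.1
  have hβ := hWb β hβ0 (by linarith)
  have hcard : (B.card : ℝ) = β * m := (div_mul_cancel₀ _ hm0.ne').symm
  -- An affine function of the indicator of B, of mean 1 under uniformity. Using W instead of β(1 -
  -- β) in the slope k keeps it bounded however small B is; the objective per symbol is then at
  -- least 1 + 2kε - k²W = 1 + kε.
  refine ⟨fun j => (1 - k * β) + k * if j ∈ B then 1 else 0, fun j => ?_, ?_⟩
  · have : 0 ≤ k * β := mul_nonneg hk.le hβ0
    dsimp only
    split_ifs <;> linarith
  · have e1 : ∑ j, ((1 - k * β) + k * if j ∈ B then 1 else 0) * q j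
        = (1 - k * β) + k * ∑ j ∈ B, q j := by
      simp only [add_mul, Finset.sum_add_distrib, ← Finset.mul_sum, hq.2, mul_assoc, ite_mul,
        one_mul, zero_mul, mul_one, Finset.sum_ite_mem, Finset.univ_inter]
    have e2 : ∑ j : Fin m, ((1 - k * β) + k * if j ∈ B then (1 : ℝ) else 0) ^ 2
        = m * (1 - k * β) ^ 2 + (2 * (1 - k * β) * k + k ^ 2) * (β * m) := by
      have : ∀ j : Fin m, ((1 - k * β) + k * if j ∈ B then (1 : ℝ) else 0) ^ 2
          = (1 - k * β) ^ 2 + (2 * (1 - k * β) * k + k ^ 2) * if j ∈ B then (1 : ℝ) else 0 := by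
        intro j; split_ifs <;> ring
      simp only [this, Finset.sum_add_distrib, ← Finset.mul_sum]
      simp [hcard]
    rw [e1, e2, hWk]
    have h1 : k * ε ≤ k * (∑ j ∈ B, q j - β) := mul_le_mul_of_nonneg_left (by linarith) hk.le
    have h2 : k ^ 2 * (β * (1 - β)) ≤ k ^ 2 * W := mul_le_mul_of_nonneg_left hβ (by positivity)
    have h3 : k ^ 2 * W = k * ε := by simp only [k]; field_simp
    have h4 : ε ^ 2 / W = k * ε := by simp only [k]; ring
    rw [h4]
    have h5 : 1 + k * ε ≤ 2 * ((1 - k * β) + k * ∑ j ∈ B, q j)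
        - ((1 - k * β) ^ 2 + (2 * (1 - k * β) * k + k ^ 2) * β) := by nlinarith
    have := mul_le_mul_of_nonneg_left h5 hm0.le
    linarith

/-! ### Chernoff bounds at fixed sample size -/

lemma prod_exp_eq {m : ℕ} (θ : ℝ) (f : ℕ → ℝ) (N : Fin m → ℕ) :
    ∏ j, Real.exp (θ * f (N j)) = Real.exp (θ * ∑ j, f (N j)) := by
  rw [← Real.exp_sum, Finset.mul_sum]

lemma hasSum_countExpect_tilted {m : ℕ} {q : Fin m → ℝ} (hq : ∀ j, 0 ≤ q j) {μ : ℝ}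
    (hμ : 0 ≤ μ) (θ V : ℝ) :
    HasSum (fun k : ℕ => μ ^ k / k.factorial *
      countExpect q k (fun N => ∏ j, Real.exp (θ * coincFunUp V (N j))))
      (∏ j, tiltedGen θ V (q j * μ)) :=
  hasSum_countExpect_prod hq hμ (g := fun _ l => Real.exp (θ * coincFunUp V l))
    (fun _ _ => (Real.exp_pos _).le) fun j => hasSum_tiltedGen θ V (q j * μ)

section

variable {L : ℕ} {v : ℕ → ℝ} (hv2 : v 2 = 0) (hv : ∀ l, 3 ≤ l → l ≤ L → 0 ≤ v l)

include hv2 hv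

/-- Markov's inequality for the exponential of the upper envelope, an increasing function of the
counts; hence ρ > 1 in the comparison with Poisson sampling. -/
lemma decisionProb_true_mul_le {n m : ℕ} (hm : 0 < m) (t : ℝ) {θ ρ : ℝ} (hθ : 0 ≤ θ)
    (hρ : 1 < ρ) (hx : ρ * n / m ≤ 1) :
    decisionProb (unif m) (modTest L v n m t) true * (1 - Real.exp (-(poissonGap ρ * n)))
      ≤ Real.exp (-(θ * (t + modMean L v n m)) + m * ((Real.exp (2 * θ) - 1) / 2 * (ρ * n / m) ^ 2
        + Real.exp (θ * ∑ i ∈ Finset.Icc 3 L, v i) * Real.exp θ ^ 3 * Real.exp (Real.exp θ)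
          * (ρ * n / m) ^ 3)) := by
  set V := ∑ i ∈ Finset.Icc 3 L, v i
  have hV : 0 ≤ V := Finset.sum_nonneg fun i hi =>
    hv i (Finset.mem_Icc.1 hi).1 (Finset.mem_Icc.1 hi).2
  set G : (Fin m → ℕ) → ℝ := fun N => ∏ j, Real.exp (θ * coincFunUp V (N j))
  have hG0 : ∀ N, 0 ≤ G N := fun N => Finset.prod_nonneg fun _ _ => (Real.exp_pos _).le
  have hGm : Monotone G := fun N N' h => Finset.prod_le_prod (fun _ _ => (Real.exp_pos _).le)
    fun j _ => Real.exp_le_exp.2 (mul_le_mul_of_nonneg_left (coincFunUp_mono hV (h j)) hθ)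
  have hu := unif_mem hm
  have hm0 : (0 : ℝ) < m := by exact_mod_cast hm
  have h1 : decisionProb (unif m) (modTest L v n m t) true
      ≤ Real.exp (-(θ * (t + modMean L v n m))) * countExpect (unif m) n G := by
    rw [← countExpect_const_mul]
    refine decisionProb_le_countExpect hu.1
      (fun N => mul_nonneg (Real.exp_pos _).le (hG0 N)) fun z hz => ?_
    rw [modTest_eq_true_iff] at hz
    simp only [G]
    rw [prod_exp_eq, ← Real.exp_add]
    refine Real.one_le_exp ?_
    have h2 : ∑ j, modFun L v (symbCount z j) ≤ ∑ j, coincFunUp V (symbCount z j) :=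
      Finset.sum_le_sum fun j _ => modFun_le_coincFunUp hv2 hv _
    nlinarith
  have h3 := depoissonize_upper_of_monotone (n := n) hρ (countExpect_monotone hu hGm)
    (fun k => countExpect_nonneg hu.1 hG0)
    (hasSum_countExpect_tilted hu.1 (by positivity : (0 : ℝ) ≤ ρ * n) θ V)
  have hx0 : ∀ j : Fin m, unif m j * (ρ * n) = ρ * n / m := fun j => by unfold unif; ring
  simp only [hx0, Finset.prod_const, Finset.card_univ, Fintype.card_fin] at h3
  have hgap : 0 ≤ 1 - Real.exp (-(poissonGap ρ * n)) := by
    have := poissonGap_pos (by linarith) hρ.ne'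
    rw [sub_nonneg, Real.exp_le_one_iff]
    exact neg_nonpos.2 (by positivity)
  have h4 := tiltedGen_le (V := V) hθ (by positivity : 0 ≤ ρ * n / m) hx
  set E := (Real.exp (2 * θ) - 1) / 2 * (ρ * n / m) ^ 2
    + Real.exp (θ * V) * Real.exp θ ^ 3 * Real.exp (Real.exp θ) * (ρ * n / m) ^ 3
  have h5 : 0 ≤ tiltedGen θ V (ρ * n / m) :=
    (hasSum_tiltedGen θ V _).nonneg fun l => by positivity
  calc _ ≤ Real.exp (-(θ * (t + modMean L v n m))) * countExpect (unif m) n G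
        * (1 - Real.exp (-(poissonGap ρ * n))) := mul_le_mul_of_nonneg_right h1 hgap
    _ ≤ Real.exp (-(θ * (t + modMean L v n m))) *
        (tiltedGen θ V (ρ * n / m) ^ m * Real.exp (-(ρ * n))) := by
        rw [mul_assoc]; exact mul_le_mul_of_nonneg_left h3 (Real.exp_pos _).le
    _ ≤ Real.exp (-(θ * (t + modMean L v n m))) *
        (Real.exp (ρ * n / m + E) ^ m * Real.exp (-(ρ * n))) := by gcongr
    _ = _ := by
        rw [← Real.exp_nat_mul, ← Real.exp_add, ← Real.exp_add]
        congr 1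
        field_simp
        ring

/-- Markov's inequality for the decreasing exponential of the lower envelope, so ρ < 1. Each symbol
uses its own tangent, at `a j` rescaled by ρn/m; the tangents add up to the dual objective, bounded
below uniformly in q. -/
lemma decisionProb_false_mul_le {ε : ℝ} {n m : ℕ} (hm : 0 < m) (hn : 0 < n) (t : ℝ) {θ ρ c A : ℝ}
    (hθ : 0 ≤ θ) (hρ0 : 0 < ρ) (hρ : ρ < 1) (hc : 0 ≤ c)
    (htan : ∀ a ≤ A * (ρ * n / m), ∀ x ≥ 0, Real.exp (Real.exp (-θ) * x) + (1 - Real.exp (-θ)) * x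
      ≤ Real.exp (x - c * (2 * a * x - a ^ 2)))
    {q : Fin m → ℝ} (hq : q ∈ altSet ε m)
    (hdual : ∃ a : Fin m → ℝ, (∀ j, a j ≤ A) ∧
      m * kappa ε ≤ 2 * m * ∑ j, a j * q j - ∑ j, a j ^ 2) :
    decisionProb q (modTest L v n m t) false * (1 - Real.exp (-(poissonGap ρ * n)))
      ≤ Real.exp (θ * (t + modMean L v n m) - c * (kappa ε * ((ρ * n) ^ 2 / m))) := by
  obtain ⟨a, haA, ha⟩ := hdual
  set G : (Fin m → ℕ) → ℝ := fun N => ∏ j, Real.exp (-θ * coincFunUp 0 (N j))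
  have hG0 : ∀ N, 0 ≤ G N := fun N => Finset.prod_nonneg fun _ _ => (Real.exp_pos _).le
  have hGm : Antitone G := fun N N' h => Finset.prod_le_prod (fun _ _ => (Real.exp_pos _).le)
    fun j _ => Real.exp_le_exp.2
      (mul_le_mul_of_nonpos_left (coincFunUp_mono le_rfl (h j)) (by linarith))
  have hu := hq.1
  have hm0 : (0 : ℝ) < m := by exact_mod_cast hm
  have hn0 : (0 : ℝ) < n := by exact_mod_cast hn
  have h1 : decisionProb q (modTest L v n m t) false
      ≤ Real.exp (θ * (t + modMean L v n m)) * countExpect q n G := by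
    rw [← countExpect_const_mul]
    refine decisionProb_le_countExpect hu.1
      (fun N => mul_nonneg (Real.exp_pos _).le (hG0 N)) fun z hz => ?_
    rw [modTest_eq_false_iff] at hz
    simp only [G]
    rw [prod_exp_eq, ← Real.exp_add]
    refine Real.one_le_exp ?_
    have h2 : ∑ j, coincFunUp 0 (symbCount z j) ≤ ∑ j, modFun L v (symbCount z j) :=
      Finset.sum_le_sum fun j _ => by
        simpa [coincFunUp] using coincFun_le_modFun hv2 hv (symbCount z j)
    nlinarith
  have h3 := depoissonize_upper_of_antitone (n := n) hρ0 hρ (countExpect_antitone hu hGm)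
    (fun k => countExpect_nonneg hu.1 hG0)
    (hasSum_countExpect_tilted hu.1 (by positivity : (0 : ℝ) ≤ ρ * n) (-θ) 0)
  simp only [tiltedGen_zero] at h3
  have hgap : 0 ≤ 1 - Real.exp (-(poissonGap ρ * n)) := by
    have := poissonGap_pos hρ0 hρ.ne
    rw [sub_nonneg, Real.exp_le_one_iff]
    exact neg_nonpos.2 (by positivity)
  set y := ρ * n / m with hy
  have hy0 : 0 < y := by positivity
  have hym : ρ * n = y * m := by rw [hy]; field_simp
  have hs1 : Real.exp (-θ) ≤ 1 := Real.exp_le_one_iff.2 (by linarith)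
  have h4 : ∏ j, (Real.exp (Real.exp (-θ) * (q j * (ρ * n)))
        + (1 - Real.exp (-θ)) * (q j * (ρ * n)))
      ≤ Real.exp (ρ * n - c * (kappa ε * ((ρ * n) ^ 2 / m))) := by
    have h5 : ∀ j, 0 ≤ q j * (ρ * n) := fun j => mul_nonneg (hu.1 j) (by positivity)
    calc _ ≤ ∏ j, Real.exp (q j * (ρ * n)
          - c * (2 * (a j * y) * (q j * (ρ * n)) - (a j * y) ^ 2)) :=
          Finset.prod_le_prod
            (fun j _ => add_nonneg (Real.exp_pos _).le (mul_nonneg (by linarith) (h5 j)))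
            fun j _ => htan _ (mul_le_mul_of_nonneg_right (haA j) hy0.le) _ (h5 j)
      _ = Real.exp (ρ * n - c * (y ^ 2 * (2 * m * ∑ j, a j * q j - ∑ j, a j ^ 2))) := by
          rw [← Real.exp_sum, Finset.sum_sub_distrib, ← Finset.sum_mul, hu.2, ← Finset.mul_sum,
            Finset.sum_sub_distrib, one_mul, mul_sub (y ^ 2), Finset.mul_sum, Finset.mul_sum,
            Finset.mul_sum]
          congr 4
          · refine Finset.sum_congr rfl fun j _ => ?_
            rw [hym]; ring
          · refine Finset.sum_congr rfl fun j _ => ?_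
            ring
      _ ≤ _ := by
          refine Real.exp_le_exp.2 ?_
          have h6 : kappa ε * ((ρ * n) ^ 2 / m)
              ≤ y ^ 2 * (2 * m * ∑ j, a j * q j - ∑ j, a j ^ 2) := by
            calc _ = y ^ 2 * (m * kappa ε) := by rw [hym]; field_simp
              _ ≤ _ := mul_le_mul_of_nonneg_left ha (by positivity)
          have := mul_le_mul_of_nonneg_left h6 hc
          linarith
  calc _ ≤ Real.exp (θ * (t + modMean L v n m)) * countExpect q n G
        * (1 - Real.exp (-(poissonGap ρ * n))) := mul_le_mul_of_nonneg_right h1 hgap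
    _ ≤ Real.exp (θ * (t + modMean L v n m)) *
        (Real.exp (ρ * n - c * (kappa ε * ((ρ * n) ^ 2 / m))) * Real.exp (-(ρ * n))) := by
        rw [mul_assoc]
        exact mul_le_mul_of_nonneg_left
          (h3.trans (mul_le_mul_of_nonneg_right h4 (Real.exp_pos _).le)) (Real.exp_pos _).le
    _ = _ := by
        rw [← Real.exp_add, ← Real.exp_add]
        congr 1
        ring

end

/-! ### Asymptotic upper bounds on the error probabilities -/

lemma eventually_half_le_gap {ρ : ℝ} (h0 : 0 < ρ) (h1 : ρ ≠ 1) :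
    ∀ᶠ n : ℕ in atTop, 1 / 2 ≤ 1 - Real.exp (-(poissonGap ρ * n)) := by
  have h : Tendsto (fun n : ℕ => 1 - Real.exp (-(poissonGap ρ * n))) atTop (𝓝 (1 - 0)) := by
    refine (Real.tendsto_exp_neg_atTop_nhds_zero.comp ?_).const_sub 1
    exact tendsto_natCast_atTop_atTop.const_mul_atTop (poissonGap_pos h0 h1)
  exact h.eventually_const_le (by norm_num)

/-- Depoissonization costs at most a factor 2, which contributes log 2 / r to the exponent. -/
lemma le_exp_of_mul_gap {P g X r b : ℝ} (hP : 0 ≤ P) (hg : 1 / 2 ≤ g) (h : P * g ≤ Real.exp X)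
    (hr : 0 < r) (hX : Real.log 2 / r + X / r ≤ b) : P ≤ Real.exp (r * b) := by
  have h1 : P ≤ 2 * Real.exp X := by nlinarith
  refine h1.trans ?_
  rw [← Real.exp_log (show (0 : ℝ) < 2 by norm_num), ← Real.exp_add]
  refine Real.exp_le_exp.2 ?_
  rwa [← add_div, div_le_iff₀' hr] at hX

lemma decisionProb_nonneg {n m : ℕ} {q : Fin m → ℝ} (hq : ∀ j, 0 ≤ q j)
    (φ : (Fin n → Fin m) → Bool) (b : Bool) : 0 ≤ decisionProb q φ b :=
  Finset.sum_nonneg fun z _ => iidWeight_nonneg hq z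

section asymptotics

variable {m : ℕ → ℕ} (hm : ∀ n, 0 < m n)
    (hnm : (fun n : ℕ => (n : ℝ)) =o[atTop] fun n => (m n : ℝ))
    (hmn : (fun n : ℕ => (m n : ℝ)) =o[atTop] fun n => (n : ℝ) ^ 2)
    {L : ℕ} {v : ℕ → ℝ} (hv2 : v 2 = 0) (hv : ∀ l, 3 ≤ l → l ≤ L → 0 ≤ v l)
    {t : ℕ → ℝ} {τ : ℝ}
    (ht : Tendsto (fun n : ℕ => (m n : ℝ) * t n / (n : ℝ) ^ 2) atTop (𝓝 τ))

include hm hnm hmn hv2 hv ht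

lemma eventually_falseAlarm_le {θ b : ℝ} (hθ : 0 ≤ θ)
    (hb : -(θ * (1 + τ)) + (Real.exp (2 * θ) - 1) / 2 < b) :
    ∀ᶠ n : ℕ in atTop, decisionProb (unif (m n)) (modTest L v n (m n) (t n)) true
      ≤ Real.exp ((n : ℝ) ^ 2 / m n * b) := by
  obtain ⟨ρ, hρb, hρ⟩ : ∃ ρ : ℝ,
      -(θ * (1 + τ)) + (Real.exp (2 * θ) - 1) / 2 * ρ ^ 2 < b ∧ 1 < ρ := by
    have hcont : ContinuousAt
        (fun ρ : ℝ => -(θ * (1 + τ)) + (Real.exp (2 * θ) - 1) / 2 * ρ ^ 2) 1 := by fun_prop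
    have h := hcont.eventually_lt_const (u := b) (by simpa using hb)
    exact ((h.filter_mono nhdsWithin_le_nhds).and
      (self_mem_nhdsWithin : Set.Ioi (1 : ℝ) ∈ 𝓝[>] 1)).exists
  set K := Real.exp (θ * ∑ i ∈ Finset.Icc 3 L, v i) * Real.exp θ ^ 3 * Real.exp (Real.exp θ)
  have hr := tendsto_normalization hm hmn
  have hx := tendsto_div_alphabet hm hnm
  have hthr := tendsto_threshold hv2 hv hm hnm ht
  have hlim : Tendsto (fun n : ℕ => Real.log 2 / ((n : ℝ) ^ 2 / m n)
      + (-(θ * ((t n + modMean L v n (m n)) / ((n : ℝ) ^ 2 / m n)))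
        + ((Real.exp (2 * θ) - 1) / 2 * ρ ^ 2 + K * ρ ^ 3 * (n / m n)))) atTop
      (𝓝 (0 + (-(θ * (1 + τ)) + ((Real.exp (2 * θ) - 1) / 2 * ρ ^ 2 + K * ρ ^ 3 * 0)))) :=
    (hr.const_div_atTop _).add ((hthr.const_mul θ).neg.add ((hx.const_mul _).const_add _))
  rw [zero_add, mul_zero, add_zero] at hlim
  have hxρ : ∀ᶠ n : ℕ in atTop, ρ * ((n : ℝ) / m n) < 1 :=
    (hx.const_mul ρ).eventually_lt_const (by simp)
  filter_upwards [hlim.eventually_lt_const hρb, hxρ, hr.eventually_gt_atTop 0,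
    eventually_half_le_gap (by linarith) hρ.ne'] with n h1 h2 h3 h4
  have hm0 : (0 : ℝ) < m n := by exact_mod_cast hm n
  have hn0 : (n : ℝ) ≠ 0 := by rintro h; simp [h] at h3
  refine le_exp_of_mul_gap (decisionProb_nonneg (unif_mem (hm n)).1 _ _) h4
    (decisionProb_true_mul_le hv2 hv (hm n) (t n) hθ hρ (by rw [mul_div_assoc]; exact h2.le)) h3 ?_
  refine le_trans (le_of_eq ?_) h1.le
  congr 1
  simp only [K]
  field_simp

lemma eventually_missedDetection_le {ε : ℝ} (hε0 : 0 < ε) (hε1 : ε < 1) {θ b : ℝ} (hθ : 0 ≤ θ)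
    (hb : θ * (1 + τ) - (1 - Real.exp (-2 * θ)) / 2 * kappa ε < b) :
    ∀ᶠ n : ℕ in atTop, ∀ q ∈ altSet ε (m n),
      decisionProb q (modTest L v n (m n) (t n)) false ≤ Real.exp ((n : ℝ) ^ 2 / m n * b) := by
  have hs2 : Real.exp (-2 * θ) = Real.exp (-θ) ^ 2 := by
    rw [← Real.exp_nat_mul]; congr 1; push_cast; ring
  rw [hs2] at hb
  set s := Real.exp (-θ) with hs
  have hs0 : 0 < s := Real.exp_pos _
  have hs1 : s ≤ 1 := Real.exp_le_one_iff.2 (by linarith)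
  -- One parameter plays two roles: the Poisson mean is ρn, and the tangent bound is used with 1 - δ
  -- = ρ. Both losses vanish as ρ tends to 1.
  obtain ⟨ρ, hρb, hρ0, hρ⟩ : ∃ ρ : ℝ,
      θ * (1 + τ) - ρ * ((1 - s ^ 2) / 2) * (kappa ε * ρ ^ 2) < b ∧ 0 < ρ ∧ ρ < 1 := by
    have hcont : ContinuousAt
        (fun ρ : ℝ => θ * (1 + τ) - ρ * ((1 - s ^ 2) / 2) * (kappa ε * ρ ^ 2)) 1 := by fun_prop
    have h := hcont.eventually_lt_const (u := b) (by simpa using hb)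
    exact ((h.filter_mono nhdsWithin_le_nhds).and
      (Ioo_mem_nhdsLT (zero_lt_one' ℝ))).exists
  obtain ⟨a₀, ha₀, htan⟩ := exists_tangent_bound hs0 hs1 (δ := 1 - ρ) (by linarith) (by linarith)
  rw [sub_sub_cancel] at htan
  obtain ⟨A, hA, hdual⟩ := exists_dual hε0 hε1
  have hr := tendsto_normalization hm hmn
  have hx := tendsto_div_alphabet hm hnm
  have hthr := tendsto_threshold hv2 hv hm hnm ht
  have hlim : Tendsto (fun n : ℕ => Real.log 2 / ((n : ℝ) ^ 2 / m n)
      + (θ * ((t n + modMean L v n (m n)) / ((n : ℝ) ^ 2 / m n))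
        - ρ * ((1 - s ^ 2) / 2) * (kappa ε * ρ ^ 2))) atTop
      (𝓝 (0 + (θ * (1 + τ) - ρ * ((1 - s ^ 2) / 2) * (kappa ε * ρ ^ 2)))) :=
    (hr.const_div_atTop _).add ((hthr.const_mul θ).sub_const _)
  rw [zero_add] at hlim
  have hxρ : ∀ᶠ n : ℕ in atTop, A * (ρ * ((n : ℝ) / m n)) < a₀ :=
    ((hx.const_mul ρ).const_mul A).eventually_lt_const (by simpa using ha₀)
  filter_upwards [hlim.eventually_lt_const hρb, hxρ, hr.eventually_gt_atTop 0,
    eventually_half_le_gap hρ0 hρ.ne] with n h1 h2 h3 h4 q hq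
  have hm0 : (0 : ℝ) < m n := by exact_mod_cast hm n
  have hn0 : (n : ℝ) ≠ 0 := by rintro h; simp [h] at h3
  refine le_exp_of_mul_gap (decisionProb_nonneg hq.1.1 _ _) h4
    (decisionProb_false_mul_le hv2 hv (hm n) (Nat.pos_of_ne_zero (by exact_mod_cast hn0)) (t n) hθ
      hρ0 hρ (c := ρ * ((1 - s ^ 2) / 2)) (mul_nonneg hρ0.le (by nlinarith))
      (fun a ha => htan a (ha.trans (by rw [mul_div_assoc]; exact h2.le))) hq
      (hdual _ q (hm n) hq)) h3 ?_
  refine le_trans (le_of_eq ?_) h1.le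
  congr 1
  field_simp

end asymptotics

/-! ### Lower bounds through the event of exactly k pairs -/

/-- The weight of a symbol in the event that exactly the symbols of `P` occur twice and no symbol
occurs more often. -/
def pairWeight {m : ℕ} (P : Finset (Fin m)) (j : Fin m) (l : ℕ) : ℝ :=
  if j ∈ P then (if l = 2 then 1 else 0) else (if l ≤ 1 then 1 else 0)

/-- The indicator of the event that exactly `k` symbols occur twice and no symbol occurs more
often. -/
def pairIndicator {m : ℕ} (k : ℕ) (N : Fin m → ℕ) : ℝ :=
  ∑ P ∈ (Finset.univ : Finset (Fin m)).powersetCard k, ∏ j, pairWeight P j (N j)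

lemma pairWeight_nonneg {m : ℕ} (P : Finset (Fin m)) (j : Fin m) (l : ℕ) :
    0 ≤ pairWeight P j l := by
  unfold pairWeight; split_ifs <;> norm_num

lemma pairWeight_le_one {m : ℕ} (P : Finset (Fin m)) (j : Fin m) (l : ℕ) :
    pairWeight P j l ≤ 1 := by
  unfold pairWeight; split_ifs <;> norm_num

lemma prod_pairWeight_ne_zero {m : ℕ} {P : Finset (Fin m)} {N : Fin m → ℕ}
    (h : ∏ j, pairWeight P j (N j) ≠ 0) (j : Fin m) :
    (j ∈ P ∧ N j = 2) ∨ (j ∉ P ∧ N j ≤ 1) := by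
  have := Finset.prod_ne_zero_iff.1 h j (Finset.mem_univ j)
  unfold pairWeight at this
  split_ifs at this <;> simp_all

/-- At counts at most 2 the envelope takes the values 0, 0, 2 whatever V is. Hence the same event
serves both error types. -/
lemma pairIndicator_le {m : ℕ} (k : ℕ) (V : ℝ) (N : Fin m → ℕ) :
    pairIndicator k N ≤ if ∑ j, coincFunUp V (N j) = 2 * (k : ℝ) then 1 else 0 := by
  classical
  -- The only set of symbols whose term can be nonzero is the set of those occurring exactly twice,
  -- so the sum has at most one nonzero term.
  set P₀ := Finset.univ.filter fun j => N j = 2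
  have huniq : ∀ P : Finset (Fin m), ∏ j, pairWeight P j (N j) ≠ 0 → P = P₀ := by
    intro P hP
    ext j
    have := prod_pairWeight_ne_zero hP j
    simp only [P₀, Finset.mem_filter, Finset.mem_univ, true_and]
    constructor
    · intro hj; rcases this with h | h
      · exact h.2
      · exact absurd hj h.1
    · intro hj; rcases this with h | h
      · exact h.1
      · omega
  by_cases h0 : ∏ j, pairWeight P₀ j (N j) = 0 ∨ P₀.card ≠ k
  · have : pairIndicator k N = 0 := by
      refine Finset.sum_eq_zero fun P hP => ?_
      by_contra hne
      have hPe := huniq P hne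
      rw [hPe] at hne hP
      rcases h0 with h | h
      · exact hne h
      · exact h (Finset.mem_powersetCard.1 hP).2
    rw [this]
    split_ifs <;> norm_num
  · push Not at h0
    have hsum : ∑ j, coincFunUp V (N j) = 2 * (k : ℝ) := by
      have h1 : ∀ j, coincFunUp V (N j) = if j ∈ P₀ then 2 else 0 := by
        intro j
        unfold coincFunUp coincFun
        rcases prod_pairWeight_ne_zero h0.1 j with ⟨h, h'⟩ | ⟨h, h'⟩
        · simp [h, h']
        · rw [if_neg (by omega), if_neg (by omega), if_neg h, add_zero]
      simp only [h1]
      rw [Finset.sum_ite_mem, Finset.univ_inter, Finset.sum_const, h0.2, nsmul_eq_mul, mul_comm]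
    rw [if_pos hsum, pairIndicator, Finset.sum_eq_single P₀]
    · exact Finset.prod_le_one (fun j _ => pairWeight_nonneg _ _ _) fun j _ =>
        pairWeight_le_one _ _ _
    · intro P _ hP
      by_contra hne
      exact hP (huniq P hne)
    · intro h
      exact absurd (Finset.mem_powersetCard.2 ⟨Finset.subset_univ _, h0.2⟩) h

lemma hasSum_pairWeight {m : ℕ} (P : Finset (Fin m)) (j : Fin m) (x : ℝ) :
    HasSum (fun l : ℕ => pairWeight P j l * x ^ l / l.factorial)
      (if j ∈ P then x ^ 2 / 2 else 1 + x) := by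
  have h : HasSum (fun l : ℕ => pairWeight P j l * x ^ l / l.factorial) _ :=
    hasSum_sum_of_ne_finset_zero (s := Finset.range 3) (fun l hl => by
      have : 3 ≤ l := by simpa using hl
      unfold pairWeight
      rw [if_neg (show ¬ l = 2 by omega), if_neg (show ¬ l ≤ 1 by omega)]
      simp)
  convert h using 1
  unfold pairWeight
  split_ifs <;> simp [Finset.sum_range_succ]

lemma hasSum_countExpect_pairIndicator {m : ℕ} {q : Fin m → ℝ} (hq : ∀ j, 0 ≤ q j) {μ : ℝ}
    (hμ : 0 ≤ μ) (k : ℕ) :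
    HasSum (fun n : ℕ => μ ^ n / n.factorial * countExpect q n (pairIndicator k))
      (∑ P ∈ (Finset.univ : Finset (Fin m)).powersetCard k,
        ∏ j, if j ∈ P then (q j * μ) ^ 2 / 2 else 1 + q j * μ) := by
  have h := hasSum_sum (s := (Finset.univ : Finset (Fin m)).powersetCard k) fun P _ =>
    hasSum_countExpect_prod hq hμ (pairWeight_nonneg P) fun j => hasSum_pairWeight P j (q j * μ)
  refine h.congr_fun fun n => ?_
  rw [← Finset.mul_sum, ← countExpect_sum]
  rfl

/-- Lower bound for the Poissonized probability of exactly `k` pairs. -/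
lemma le_poisson_pairs {m : ℕ} (x : Fin m → ℝ) (hx : ∀ j, 0 ≤ x j) {ξ : ℝ} (hξ : ∀ j, x j ≤ ξ)
    (k : ℕ) :
    Real.exp (-(∑ j, x j ^ 2 / 2)) *
        (max 0 ((∑ j, x j ^ 2 / 2) / (1 + ξ) - k * ξ ^ 2) ^ k / k.factorial)
      ≤ (∑ P ∈ (Finset.univ : Finset (Fin m)).powersetCard k,
        ∏ j, if j ∈ P then x j ^ 2 / 2 else 1 + x j) * Real.exp (-∑ j, x j) := by
  classical
  -- Factoring out ∏ (1 + x j), the probability that all symbols occur at most once up to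
  -- normalization, leaves the elementary symmetric function of degree k in `y`.
  set y : Fin m → ℝ := fun j => x j ^ 2 / 2 / (1 + x j)
  have h1 : ∀ P : Finset (Fin m), (∏ j, if j ∈ P then x j ^ 2 / 2 else 1 + x j)
      = (∏ j, (1 + x j)) * ∏ j ∈ P, y j := by
    intro P
    rw [← Finset.univ_inter P, ← Finset.prod_ite_mem, ← Finset.prod_mul_distrib,
      Finset.univ_inter]
    refine Finset.prod_congr rfl fun j _ => ?_
    have : 1 + x j ≠ 0 := by have := hx j; positivity
    simp only [y]
    split_ifs
    · field_simp
    · ring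
  simp only [h1]
  rw [← Finset.mul_sum]
  have hy0 : ∀ j, 0 ≤ y j := fun j => by have := hx j; simp only [y]; positivity
  have hyY : ∀ j, y j ≤ ξ ^ 2 := fun j => by
    have h2 := hx j
    have h3 : x j ^ 2 ≤ ξ ^ 2 := by gcongr; exact hξ j
    have h4 : y j ≤ x j ^ 2 / 2 := div_le_self (by positivity) (by linarith)
    nlinarith [sq_nonneg (x j)]
  have h2 := pow_div_factorial_le_esymm Finset.univ k hy0 hyY (sq_nonneg ξ)
  have h3 : (∑ j, x j ^ 2 / 2) / (1 + ξ) ≤ ∑ j, y j := by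
    rw [Finset.sum_div]
    refine Finset.sum_le_sum fun j _ => ?_
    have := hx j
    simp only [y]
    gcongr
    exact hξ j
  have h4 : max 0 ((∑ j, x j ^ 2 / 2) / (1 + ξ) - k * ξ ^ 2)
      ≤ max 0 (∑ j, y j - k * ξ ^ 2) := max_le_max le_rfl (by linarith)
  have h5 : max 0 ((∑ j, x j ^ 2 / 2) / (1 + ξ) - k * ξ ^ 2) ^ k / (k.factorial : ℝ)
      ≤ ∑ P ∈ (Finset.univ : Finset (Fin m)).powersetCard k, ∏ j ∈ P, y j := by
    refine le_trans ?_ h2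
    gcongr
  have h6 : Real.exp (-(∑ j, x j ^ 2 / 2)) ≤ (∏ j, (1 + x j)) * Real.exp (-∑ j, x j) := by
    have h7 : ∏ j, Real.exp (x j - x j ^ 2 / 2) ≤ ∏ j, (1 + x j) :=
      Finset.prod_le_prod (fun _ _ => (Real.exp_pos _).le) fun j _ => by
        have hj := hx j
        have := Real.quadratic_le_exp_of_nonneg hj
        rw [← Real.le_log_iff_exp_le (by positivity)]
        have h8 := Real.le_log_one_add_of_nonneg hj
        refine le_trans ?_ h8
        rw [le_div_iff₀ (by positivity)]
        nlinarith [mul_nonneg hj (sq_nonneg (x j))]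
    rw [← Real.exp_sum, Finset.sum_sub_distrib] at h7
    calc _ = Real.exp (∑ j, x j - ∑ j, x j ^ 2 / 2) * Real.exp (-∑ j, x j) := by
          rw [← Real.exp_add]; congr 1; ring
      _ ≤ _ := mul_le_mul_of_nonneg_right h7 (Real.exp_pos _).le
  calc _ ≤ ((∏ j, (1 + x j)) * Real.exp (-∑ j, x j)) *
        ∑ P ∈ (Finset.univ : Finset (Fin m)).powersetCard k, ∏ j ∈ P, y j :=
        mul_le_mul h6 h5 (by positivity) ((Real.exp_pos _).le.trans h6)
    _ = _ := by ring

/-- The lower bound on Poisson probabilities used for both kinds of errors. -/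
def pairBound (Λ ξ : ℝ) (k : ℕ) : ℝ :=
  Real.exp (-Λ) * (max 0 (Λ / (1 + ξ) - k * ξ ^ 2) ^ k / k.factorial)

lemma pairBound_le {m n : ℕ} {q : Fin m → ℝ} (hq : q ∈ stdSimplex ℝ (Fin m)) {ρ ξ : ℝ}
    (hρ : 0 < ρ) (hξ : ∀ j, q j * (ρ * n) ≤ ξ) (k : ℕ) :
    pairBound ((ρ * n) ^ 2 * (∑ j, q j ^ 2) / 2) ξ k
      ≤ (∑ P ∈ (Finset.univ : Finset (Fin m)).powersetCard k,
        ∏ j, if j ∈ P then (q j * (ρ * n)) ^ 2 / 2 else 1 + q j * (ρ * n))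
          * Real.exp (-(ρ * n)) := by
  have h := le_poisson_pairs (fun j => q j * (ρ * n))
    (fun j => mul_nonneg (hq.1 j) (by positivity)) hξ k
  have h1 : ∑ j, (q j * (ρ * n)) ^ 2 / 2 = (ρ * n) ^ 2 * (∑ j, q j ^ 2) / 2 := by
    rw [← Finset.sum_div, Finset.mul_sum]
    congr 1
    exact Finset.sum_congr rfl fun j _ => by ring
  rw [h1, ← Finset.sum_mul, hq.2, one_mul] at h
  exact h

section

variable {L : ℕ} {v : ℕ → ℝ} (hv2 : v 2 = 0) (hv : ∀ l, 3 ≤ l → l ≤ L → 0 ≤ v l)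

include hv2 hv

/-- With 2k at or above the threshold, the pair event lies inside the increasing event that the
lower envelope reaches the threshold, which forces an alarm. -/
lemma le_decisionProb_true {m n : ℕ} {q : Fin m → ℝ} (hq : q ∈ stdSimplex ℝ (Fin m))
    {t ρ ξ : ℝ} (hρ0 : 0 < ρ) (hρ : ρ < 1) (hξ : ∀ j, q j * (ρ * n) ≤ ξ) {k : ℕ}
    (hk : t + modMean L v n m ≤ 2 * k) :
    pairBound ((ρ * n) ^ 2 * (∑ j, q j ^ 2) / 2) ξ k - Real.exp (-(poissonGap ρ * n))
      ≤ decisionProb q (modTest L v n m t) true := by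
  classical
  set F : (Fin m → ℕ) → ℝ := fun N =>
    if t + modMean L v n m ≤ ∑ j, coincFun (N j) then 1 else 0
  have hF0 : ∀ N, 0 ≤ F N := fun N => by simp only [F]; split_ifs <;> norm_num
  have hF1 : ∀ N, F N ≤ 1 := fun N => by simp only [F]; split_ifs <;> norm_num
  have hFm : Monotone F := by
    intro N N' h
    have : ∑ j, coincFun (N j) ≤ ∑ j, coincFun (N' j) :=
      Finset.sum_le_sum fun j _ => coincFun_mono (h j)
    simp only [F]
    split_ifs <;> linarith
  have h1 := depoissonize_lower_of_monotone (n := n) hρ0 hρ (countExpect_monotone hq hFm)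
    (fun k => countExpect_nonneg hq.1 hF0)
    (fun i => (countExpect_mono hq.1 hF1).trans (countExpect_const hq.2 1).le)
    (c := fun i => countExpect q i (pairIndicator k))
    (fun i => countExpect_mono hq.1 fun N => by
      refine (pairIndicator_le k 0 N).trans ?_
      simp only [coincFunUp, ite_self, add_zero, F]
      split_ifs <;> linarith)
    (hasSum_countExpect_pairIndicator hq.1 (by positivity) k)
  have h2 := pairBound_le hq hρ0 hξ k
  refine (sub_le_sub_right h2 _).trans (h1.trans ?_)
  refine countExpect_le_decisionProb hq.1 hF1 fun z hz => ?_
  rw [Ne, modTest_eq_true_iff] at hz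
  have h3 : ∑ j, coincFun (symbCount z j) ≤ ∑ j, modFun L v (symbCount z j) :=
    Finset.sum_le_sum fun j _ => coincFun_le_modFun hv2 hv _
  simp only [F]
  rw [if_neg (by linarith)]

/-- With 2k strictly below the threshold, the pair event lies inside the decreasing event that the
upper envelope stays below it, which excludes an alarm. -/
lemma le_decisionProb_false {m n : ℕ} {q : Fin m → ℝ} (hq : q ∈ stdSimplex ℝ (Fin m))
    {t ρ ξ : ℝ} (hρ : 1 < ρ) (hξ : ∀ j, q j * (ρ * n) ≤ ξ) {k : ℕ}
    (hk : 2 * k < t + modMean L v n m) :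
    pairBound ((ρ * n) ^ 2 * (∑ j, q j ^ 2) / 2) ξ k - Real.exp (-(poissonGap ρ * n))
      ≤ decisionProb q (modTest L v n m t) false := by
  classical
  set V := ∑ i ∈ Finset.Icc 3 L, v i
  have hV : 0 ≤ V := Finset.sum_nonneg fun i hi =>
    hv i (Finset.mem_Icc.1 hi).1 (Finset.mem_Icc.1 hi).2
  set F : (Fin m → ℕ) → ℝ := fun N =>
    if ∑ j, coincFunUp V (N j) < t + modMean L v n m then 1 else 0
  have hF0 : ∀ N, 0 ≤ F N := fun N => by simp only [F]; split_ifs <;> norm_num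
  have hF1 : ∀ N, F N ≤ 1 := fun N => by simp only [F]; split_ifs <;> norm_num
  have hFm : Antitone F := by
    intro N N' h
    have : ∑ j, coincFunUp V (N j) ≤ ∑ j, coincFunUp V (N' j) :=
      Finset.sum_le_sum fun j _ => coincFunUp_mono hV (h j)
    simp only [F]
    split_ifs <;> linarith
  have h1 := depoissonize_lower_of_antitone (n := n) hρ (countExpect_antitone hq hFm)
    (fun k => countExpect_nonneg hq.1 hF0)
    (fun i => (countExpect_mono hq.1 hF1).trans (countExpect_const hq.2 1).le)
    (c := fun i => countExpect q i (pairIndicator k))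
    (fun i => countExpect_mono hq.1 fun N => by
      refine (pairIndicator_le k V N).trans ?_
      simp only [F]
      split_ifs <;> linarith)
    (hasSum_countExpect_pairIndicator hq.1 (by positivity) k)
  have h2 := pairBound_le hq (by linarith : 0 < ρ) hξ k
  refine (sub_le_sub_right h2 _).trans (h1.trans ?_)
  refine countExpect_le_decisionProb hq.1 hF1 fun z hz => ?_
  rw [Ne, modTest_eq_false_iff] at hz
  have h3 : ∑ j, modFun L v (symbCount z j) ≤ ∑ j, coincFunUp V (symbCount z j) :=
    Finset.sum_le_sum fun j _ => modFun_le_coincFunUp hv2 hv _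
  simp only [F]
  rw [if_neg (by linarith)]

end

/-! ### The Poisson large deviations rate -/

/-- Asymptotics of `pairBound`: the Poisson large deviations rate. -/
lemma eventually_le_pairBound {r Λ ξ e : ℕ → ℝ} {k : ℕ → ℕ} {a b B : ℝ} (ha : 0 < a) (hb : 0 < b)
    (hr : Tendsto r atTop atTop) (hk : Tendsto (fun n => k n / r n) atTop (𝓝 a))
    (hΛ : Tendsto (fun n => Λ n / r n) atTop (𝓝 b)) (hξ : Tendsto ξ atTop (𝓝 0))
    (he : Tendsto (fun n => e n / r n) atTop atTop)
    (hB : b - a + a * Real.log (a / b) < B) :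
    ∀ᶠ n in atTop, Real.exp (-(r n * B)) ≤ pairBound (Λ n) (ξ n) (k n) - Real.exp (-e n) := by
  -- The main term is bounded with the better rate B'; the room between B' and B then absorbs the
  -- subtracted depoissonization error.
  obtain ⟨B', hB1, hB2⟩ := exists_between hB
  have hkr : Tendsto (fun n => (k n : ℝ)) atTop atTop := by
    refine (hk.pos_mul_atTop ha hr).congr' ?_
    filter_upwards [hr.eventually_gt_atTop 0] with n hn
    field_simp
  have hlogk : Tendsto (fun n => Real.log (k n) / r n) atTop (𝓝 0) := by
    have h1 : Tendsto (fun n => Real.log (k n) / (k n : ℝ)) atTop (𝓝 0) :=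
      (Real.isLittleO_log_id_atTop.tendsto_div_nhds_zero).comp hkr
    have h2 := h1.mul hk
    rw [zero_mul] at h2
    refine h2.congr' ?_
    filter_upwards [hkr.eventually_gt_atTop 0] with n hn
    field_simp
  have hW : Tendsto (fun n => (Λ n / (1 + ξ n) - k n * ξ n ^ 2) / r n) atTop (𝓝 b) := by
    have h1 : Tendsto (fun n => (Λ n / r n) / (1 + ξ n) - (k n / r n) * ξ n ^ 2) atTop
        (𝓝 (b / (1 + 0) - a * 0 ^ 2)) :=
      (hΛ.div (hξ.const_add 1) (by norm_num)).sub (hk.mul (hξ.pow 2))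
    simp only [add_zero, div_one, ne_eq, OfNat.ofNat_ne_zero, not_false_eq_true, zero_pow, mul_zero,
      sub_zero] at h1
    refine h1.congr fun n => ?_
    ring
  have hlim : Tendsto (fun n => Λ n / r n - k n / r n
      + (k n / r n) * Real.log ((k n / r n) / ((Λ n / (1 + ξ n) - k n * ξ n ^ 2) / r n))
      + Real.log (k n) / r n + 1 / r n) atTop
      (𝓝 (b - a + a * Real.log (a / b) + 0 + 0)) :=
    (((hΛ.sub hk).add (hk.mul ((hk.div hW hb.ne').log (div_pos ha hb).ne'))).add hlogk).add
      (hr.const_div_atTop 1)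
  rw [add_zero, add_zero] at hlim
  filter_upwards [hlim.eventually_lt_const hB1, hr.eventually_gt_atTop 0,
    hkr.eventually_gt_atTop 0, hW.eventually_const_lt hb, he.eventually_ge_atTop B,
    hr.eventually_ge_atTop (Real.log 2 / (B - B'))] with n h1 h2 h3 h4 h5 h6
  have h7 : Real.exp (-(r n * B')) ≤ pairBound (Λ n) (ξ n) (k n) := by
    set W := Λ n / (1 + ξ n) - k n * ξ n ^ 2
    have hW0 : 0 < W := by
      have := mul_pos h4 h2
      rwa [div_mul_cancel₀ _ h2.ne'] at this
    have hk0 : 0 < k n := by exact_mod_cast h3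
    have h8 : Real.log ((k n / r n) / (W / r n)) = Real.log (k n) - Real.log W := by
      rw [div_div_div_cancel_right₀ h2.ne', Real.log_div h3.ne' hW0.ne']
    rw [h8] at h1
    have h9 : Λ n - k n + k n * (Real.log (k n) - Real.log W) + Real.log (k n) + 1 ≤ r n * B' := by
      have := (mul_lt_mul_of_pos_left h1 h2).le
      refine le_trans (le_of_eq ?_) this
      field_simp
    unfold pairBound
    rw [max_eq_right hW0.le]
    calc Real.exp (-(r n * B'))
        ≤ Real.exp (-Λ n + (k n * Real.log W
            - (((k n + 1 : ℕ) : ℝ) * Real.log (k n) + (1 - k n)))) := by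
          refine Real.exp_le_exp.2 ?_
          push_cast
          linarith
      _ = Real.exp (-Λ n) * (W ^ k n / ((k n : ℝ) ^ (k n + 1) * Real.exp (1 - k n))) := by
          rw [Real.exp_add, Real.exp_sub, Real.exp_add, Real.exp_nat_mul, Real.exp_nat_mul,
            Real.exp_log hW0, Real.exp_log h3]
      _ ≤ _ := by
          gcongr
          exact factorial_le_pow_mul_exp hk0
  have h8 : 2 * Real.exp (-(r n * B)) ≤ Real.exp (-(r n * B')) := by
    rw [← Real.exp_log (show (0 : ℝ) < 2 by norm_num), ← Real.exp_add]
    refine Real.exp_le_exp.2 ?_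
    rw [div_le_iff₀ (by linarith)] at h6
    linarith
  have h9 : Real.exp (-e n) ≤ Real.exp (-(r n * B)) := by
    refine Real.exp_le_exp.2 ?_
    rw [le_div_iff₀ h2] at h5
    linarith
  linarith

/-! ### Least favourable alternatives -/

/-- Two-valued p.m.f.s in the alternative. -/
lemma exists_two_valued {ε e : ℝ} {m c : ℕ} (hc0 : 0 < c) (hcm : c < m) (he0 : 0 ≤ e)
    (hε : ε ≤ e) (he : e ≤ 1 - (c : ℝ) / m) :
    ∃ q ∈ altSet ε m, (∀ j, q j ≤ (1 + e / ((c : ℝ) / m)) / m) ∧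
      ∑ j, q j ^ 2 = (1 + e ^ 2 / ((c : ℝ) / m * (1 - (c : ℝ) / m))) / m := by
  classical
  obtain ⟨B, -, hB⟩ := Finset.exists_subset_card_eq
    (s := (Finset.univ : Finset (Fin m))) (n := c) (by simpa using hcm.le)
  have hm0 : (0 : ℝ) < m := by exact_mod_cast hc0.trans hcm
  have hc0' : (0 : ℝ) < c := by exact_mod_cast hc0
  have hβ0 : 0 < (c : ℝ) / m := by positivity
  have hβ1 : 0 < 1 - (c : ℝ) / m := by
    rw [sub_pos, div_lt_one hm0]; exact_mod_cast hcm
  have hcard : (B.card : ℝ) = (c : ℝ) / m * m := by rw [hB]; field_simp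
  generalize (c : ℝ) / m = β at *
  -- Relative to uniformity, the density is u off B and u + w on B: mass e is moved evenly from the
  -- complement of B onto B.
  set u := 1 - e / (1 - β) with hu
  set w := e / β + e / (1 - β) with hw
  have hu0 : 0 ≤ u := by rw [hu, sub_nonneg, div_le_one hβ1]; exact he
  have hw0 : 0 ≤ w := by positivity
  have huw : u + w = 1 + e / β := by rw [hu, hw]; ring
  set q : Fin m → ℝ := fun j => (u + w * if j ∈ B then 1 else 0) / m with hq
  have hsum : ∑ j, q j = 1 := by
    rw [hq, ← Finset.sum_div, Finset.sum_add_distrib, ← Finset.mul_sum, Finset.sum_boole]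
    simp only [Finset.sum_const, Finset.card_univ, Fintype.card_fin, nsmul_eq_mul,
      Finset.filter_univ_mem, hcard]
    rw [hu, hw]
    field_simp
    ring
  have hqB : ∑ j ∈ B, q j = β + e := by
    rw [Finset.sum_congr rfl (g := fun _ => (u + w) / m)
      (fun j hj => by simp only [hq, if_pos hj, mul_one]), Finset.sum_const, nsmul_eq_mul, hcard,
      huw]
    field_simp
  have hpB : ∑ j ∈ B, unif m j = β := by
    simp only [unif, Finset.sum_const, nsmul_eq_mul, hcard]
    field_simp
  refine ⟨q, ⟨⟨fun j => ?_, hsum⟩, ?_⟩, fun j => ?_, ?_⟩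
  · simp only [hq]
    split_ifs <;> positivity
  · refine le_trans ?_ (le_ciSup (f := fun B : Finset (Fin m) =>
      |∑ j ∈ B, q j - ∑ j ∈ B, unif m j|) (Set.finite_range _).bddAbove B)
    rw [hqB, hpB, add_sub_cancel_left]
    exact hε.trans (le_abs_self e)
  · rw [← huw]
    simp only [hq]
    gcongr
    split_ifs <;> linarith
  · have h1 : ∀ j, q j ^ 2 = (u ^ 2 + (2 * u * w + w ^ 2) * if j ∈ B then 1 else 0) / m ^ 2 := by
      intro j
      simp only [hq]
      split_ifs <;> ring
    simp only [h1]
    rw [← Finset.sum_div, Finset.sum_add_distrib, ← Finset.mul_sum, Finset.sum_boole]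
    simp only [Finset.sum_const, Finset.card_univ, Fintype.card_fin, nsmul_eq_mul,
      Finset.filter_univ_mem, hcard]
    rw [hu, hw]
    field_simp
    ring

/-- Asymptotically least favourable alternatives. -/
lemma exists_least_favourable {ε : ℝ} (hε0 : 0 < ε) (hε1 : ε < 1) :
    ∃ C : ℝ, ∃ K : ℕ → ℝ, Tendsto K atTop (𝓝 (kappa ε)) ∧
      ∀ᶠ m : ℕ in atTop, ∃ q ∈ altSet ε m, (∀ j, q j ≤ C / m) ∧ ∑ j, q j ^ 2 = K m / m := by
  obtain ⟨w, hw0, hw1, hwε, hwk, hw⟩ : ∃ w : ℝ, 0 < w ∧ w < 1 ∧ ε ≤ 1 - w ∧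
      kappa ε = 1 + ε ^ 2 / (w * (1 - w)) ∧ (ε < 1 / 2 ∨ w = 1 - ε) := by
    unfold kappa
    split_ifs with h
    · exact ⟨1 / 2, by norm_num, by norm_num, by linarith, by ring, Or.inl h⟩
    · push Not at h
      refine ⟨1 - ε, by linarith, by linarith, by linarith, ?_, Or.inr rfl⟩
      have : 1 - ε ≠ 0 := by linarith
      rw [sub_sub_cancel]
      field_simp
  -- Rounding down gives β m ≤ w, which leaves room to move mass at least ε out of the complement of
  -- B.
  set β : ℕ → ℝ := fun m => (⌊w * m⌋₊ : ℝ) / m with hβ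
  have hβlim : Tendsto β atTop (𝓝 w) :=
    (tendsto_nat_floor_mul_div_atTop hw0.le).comp tendsto_natCast_atTop_atTop
  have hβw : ∀ m : ℕ, 0 < m → β m ≤ w := fun m hm => by
    have hm0 : (0 : ℝ) < m := by exact_mod_cast hm
    rw [hβ, div_le_iff₀ hm0]
    exact Nat.floor_le (by positivity)
  -- When w = 1 - ε the whole complement is emptied, so its mass 1 - β m, slightly more than ε after
  -- rounding, has to be moved.
  obtain ⟨e, helim, he⟩ : ∃ e : ℕ → ℝ, Tendsto e atTop (𝓝 ε) ∧
      ∀ m : ℕ, 0 < m → ε ≤ e m ∧ e m ≤ 1 - β m := by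
    rcases hw with h | h
    · exact ⟨fun _ => ε, tendsto_const_nhds, fun m hm => ⟨le_rfl, by linarith [hβw m hm]⟩⟩
    · refine ⟨fun m => 1 - β m, ?_, fun m hm => ⟨by linarith [hβw m hm], le_rfl⟩⟩
      have := hβlim.const_sub 1
      rwa [h, sub_sub_cancel] at this
  refine ⟨1 + 1 / (w / 2), fun m => 1 + e m ^ 2 / (β m * (1 - β m)), ?_, ?_⟩
  · rw [hwk]
    refine ((helim.pow 2).div (hβlim.mul (hβlim.const_sub 1)) ?_).const_add 1
    exact (mul_pos hw0 (by linarith)).ne'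
  · filter_upwards [eventually_gt_atTop 0, hβlim.eventually_const_lt (half_lt_self hw0)]
      with m hm hm2
    have hm0 : (0 : ℝ) < m := by exact_mod_cast hm
    obtain ⟨he1, he2⟩ := he m hm
    have hc0 : 0 < ⌊w * m⌋₊ := by
      rcases Nat.eq_zero_or_pos ⌊w * m⌋₊ with h | h
      · simp only [hβ, h, Nat.cast_zero, zero_div] at hm2; linarith
      · exact h
    have hcm : ⌊w * m⌋₊ < m := by
      have h : (⌊w * m⌋₊ : ℝ) < m := (Nat.floor_le (by positivity)).trans_lt (by nlinarith)
      exact_mod_cast h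
    obtain ⟨q, hq, hq1, hq2⟩ := exists_two_valued hc0 hcm (hε0.le.trans he1) he1 he2
    refine ⟨q, hq, fun j => (hq1 j).trans ?_, hq2⟩
    have : e m ≤ 1 := he2.trans (by linarith [(half_pos hw0).trans hm2])
    have h0 : 0 ≤ e m := hε0.le.trans he1
    gcongr

/-! ### Asymptotic lower bounds on the error probabilities -/

section asymptotics

variable {m : ℕ → ℕ} (hm : ∀ n, 0 < m n)
    (hnm : (fun n : ℕ => (n : ℝ)) =o[atTop] fun n => (m n : ℝ))
    (hmn : (fun n : ℕ => (m n : ℝ)) =o[atTop] fun n => (n : ℝ) ^ 2)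

include hm hnm in
lemma tendsto_alphabet : Tendsto m atTop atTop := by
  have hx := tendsto_div_alphabet hm hnm
  refine tendsto_atTop_mono' atTop ?_ tendsto_id
  filter_upwards [hx.eventually_lt_const zero_lt_one] with n hn
  have hm0 : (0 : ℝ) < m n := by exact_mod_cast hm n
  rw [div_lt_one hm0] at hn
  exact (by exact_mod_cast hn : n < m n).le

include hm hnm in
-- The depoissonization error decays at speed n, and n divided by n²/m is m/n → ∞.
lemma tendsto_gap_div {ρ : ℝ} (h0 : 0 < ρ) (h1 : ρ ≠ 1) :
    Tendsto (fun n : ℕ => poissonGap ρ * n / ((n : ℝ) ^ 2 / m n)) atTop atTop := by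
  have hx := tendsto_div_alphabet hm hnm
  have h2 : ∀ᶠ n : ℕ in atTop, (0 : ℝ) < n / m n := by
    filter_upwards [eventually_gt_atTop 0] with n hn
    have : (0 : ℝ) < m n := by exact_mod_cast hm n
    positivity
  have h3 := (tendsto_nhdsWithin_iff.2 ⟨hx, h2⟩ : Tendsto (fun n : ℕ => (n : ℝ) / m n) atTop (𝓝[>] 0)).inv_tendsto_nhdsGT_zero
  refine (h3.const_mul_atTop (poissonGap_pos h0 h1)).congr' ?_
  filter_upwards [eventually_gt_atTop 0] with n hn
  have : (0 : ℝ) < m n := by exact_mod_cast hm n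
  simp only [Pi.inv_apply]
  field_simp

lemma tendsto_ceil_div {r : ℕ → ℝ} (hr : Tendsto r atTop atTop) {a : ℝ} (ha : 0 ≤ a) :
    Tendsto (fun n => (⌈a * r n⌉₊ : ℝ) / r n) atTop (𝓝 a) :=
  (tendsto_nat_ceil_mul_div_atTop ha).comp hr

variable {L : ℕ} {v : ℕ → ℝ} (hv2 : v 2 = 0) (hv : ∀ l, 3 ≤ l → l ≤ L → 0 ≤ v l)
    {t : ℕ → ℝ} {τ : ℝ}
    (ht : Tendsto (fun n : ℕ => (m n : ℝ) * t n / (n : ℝ) ^ 2) atTop (𝓝 τ))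

include hm hnm hmn hv2 hv ht

lemma eventually_le_falseAlarm (hτ : 0 ≤ τ) {B : ℝ}
    (hB : 1 / 2 - (1 + τ) / 2 + (1 + τ) / 2 * Real.log (1 + τ) < B) :
    ∀ᶠ n : ℕ in atTop, Real.exp (-((n : ℝ) ^ 2 / m n * B))
      ≤ decisionProb (unif (m n)) (modTest L v n (m n) (t n)) true := by
  -- δ perturbs both the Poisson mean, to (1 - δ)n, and the number of pairs, to just above (1 +
  -- τ)r/2 so that the threshold is eventually reached.
  obtain ⟨δ, hδB, hδ0, hδ1⟩ : ∃ δ : ℝ, (1 - δ) ^ 2 / 2 - (1 + τ + δ) / 2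
      + (1 + τ + δ) / 2 * Real.log ((1 + τ + δ) / 2 / ((1 - δ) ^ 2 / 2)) < B ∧ 0 < δ ∧ δ < 1 := by
    have hcont : ContinuousAt (fun δ : ℝ => (1 - δ) ^ 2 / 2 - (1 + τ + δ) / 2
        + (1 + τ + δ) / 2 * Real.log ((1 + τ + δ) / 2 / ((1 - δ) ^ 2 / 2))) 0 := by
      have h1 : ContinuousAt (fun δ : ℝ => (1 + τ + δ) / 2 / ((1 - δ) ^ 2 / 2)) 0 :=
        ContinuousAt.div (by fun_prop) (by fun_prop) (by norm_num)
      have h2 := h1.log (by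
        have : 0 < (1 + τ + 0) / 2 / ((1 - 0) ^ 2 / 2) := by positivity
        exact this.ne')
      fun_prop
    have h := hcont.eventually_lt_const (u := B) (by
      simp only [add_zero, sub_zero, one_pow]
      rwa [div_div_div_cancel_right₀ two_ne_zero, div_one])
    exact ((h.filter_mono nhdsWithin_le_nhds).and (Ioo_mem_nhdsGT (zero_lt_one' ℝ))).exists
  have hr := tendsto_normalization hm hmn
  have hx := tendsto_div_alphabet hm hnm
  have hthr := tendsto_threshold hv2 hv hm hnm ht
  have hk := tendsto_ceil_div hr (a := (1 + τ + δ) / 2) (by positivity)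
  have hΛ : Tendsto (fun n : ℕ => (((1 - δ) * n) ^ 2 * (∑ j, unif (m n) j ^ 2) / 2)
      / ((n : ℝ) ^ 2 / m n)) atTop (𝓝 ((1 - δ) ^ 2 / 2)) := by
    refine tendsto_const_nhds.congr' ?_
    filter_upwards [eventually_gt_atTop 0] with n hn
    have : (0 : ℝ) < m n := by exact_mod_cast hm n
    simp only [unif, Finset.sum_const, Finset.card_univ, Fintype.card_fin, nsmul_eq_mul]
    field_simp
  have hρ : 0 < 1 - δ := by linarith
  have hlow := eventually_le_pairBound (by positivity : 0 < (1 + τ + δ) / 2)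
    (by positivity : 0 < (1 - δ) ^ 2 / 2) hr hk hΛ (ξ := fun n => (1 - δ) * ((n : ℝ) / m n))
    (by simpa using hx.const_mul (1 - δ))
    (tendsto_gap_div hm hnm hρ (by linarith : (1 - δ) ≠ 1)) hδB
  filter_upwards [hlow, hr.eventually_gt_atTop 0,
    hthr.eventually_lt_const (show 1 + τ < 1 + τ + δ by linarith)] with n h1 h2 h3
  refine h1.trans (le_decisionProb_true hv2 hv (unif_mem (hm n)) hρ (by linarith) (fun j => ?_) ?_)
  · unfold unif
    exact le_of_eq (by ring)
  · rw [div_lt_iff₀ h2] at h3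
    have := Nat.le_ceil ((1 + τ + δ) / 2 * ((n : ℝ) ^ 2 / m n))
    linarith

lemma eventually_le_missedDetection {ε : ℝ} (hε0 : 0 < ε) (hε1 : ε < 1) (hτ : 0 ≤ τ) {B : ℝ}
    (hB : kappa ε / 2 - (1 + τ) / 2 + (1 + τ) / 2 * Real.log ((1 + τ) / kappa ε) < B) :
    ∀ᶠ n : ℕ in atTop, ∃ q ∈ altSet ε (m n), Real.exp (-((n : ℝ) ^ 2 / m n * B))
      ≤ decisionProb q (modTest L v n (m n) (t n)) false := by
  have hκ : 0 < kappa ε := by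
    have : 0 < 1 - ε := by linarith
    unfold kappa; split_ifs <;> positivity
  obtain ⟨δ, hδB, hδ0, hδ1⟩ : ∃ δ : ℝ, (1 + δ) ^ 2 * kappa ε / 2 - (1 + τ - δ) / 2
      + (1 + τ - δ) / 2 * Real.log ((1 + τ - δ) / 2 / ((1 + δ) ^ 2 * kappa ε / 2)) < B
      ∧ 0 < δ ∧ δ < 1 := by
    have hcont : ContinuousAt (fun δ : ℝ => (1 + δ) ^ 2 * kappa ε / 2 - (1 + τ - δ) / 2
        + (1 + τ - δ) / 2 * Real.log ((1 + τ - δ) / 2 / ((1 + δ) ^ 2 * kappa ε / 2))) 0 := by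
      have h1 : ContinuousAt
          (fun δ : ℝ => (1 + τ - δ) / 2 / ((1 + δ) ^ 2 * kappa ε / 2)) 0 :=
        ContinuousAt.div (by fun_prop) (by fun_prop) (by simpa using hκ.ne')
      have h2 := h1.log (by
        have : 0 < (1 + τ - 0) / 2 / ((1 + 0) ^ 2 * kappa ε / 2) := by
          rw [sub_zero]; positivity
        exact this.ne')
      fun_prop
    have h := hcont.eventually_lt_const (u := B) (by
      simp only [add_zero, sub_zero, one_pow, one_mul]
      rwa [div_div_div_cancel_right₀ two_ne_zero])
    exact ((h.filter_mono nhdsWithin_le_nhds).and (Ioo_mem_nhdsGT (zero_lt_one' ℝ))).exists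
  have hr := tendsto_normalization hm hmn
  have hx := tendsto_div_alphabet hm hnm
  have hthr := tendsto_threshold hv2 hv hm hnm ht
  obtain ⟨C, K, hK, hex⟩ := exists_least_favourable hε0 hε1
  have ha : 0 < (1 + τ - δ) / 2 := by linarith
  have hk := tendsto_ceil_div hr ha.le
  have hΛ : Tendsto (fun n : ℕ => (((1 + δ) * n) ^ 2 * (K (m n) / m n) / 2)
      / ((n : ℝ) ^ 2 / m n)) atTop (𝓝 ((1 + δ) ^ 2 * kappa ε / 2)) := by
    refine (((hK.comp (tendsto_alphabet hm hnm)).const_mul ((1 + δ) ^ 2)).div_const 2).congr' ?_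
    filter_upwards [eventually_gt_atTop 0] with n hn
    have : (0 : ℝ) < m n := by exact_mod_cast hm n
    simp only [Function.comp_apply]
    field_simp
  have hρ : 0 < 1 + δ := by linarith
  have hlow := eventually_le_pairBound ha
    (by positivity : 0 < (1 + δ) ^ 2 * kappa ε / 2) hr hk hΛ
    (ξ := fun n => C * (1 + δ) * ((n : ℝ) / m n))
    (by simpa using hx.const_mul (C * (1 + δ)))
    (tendsto_gap_div hm hnm hρ (by linarith : (1 + δ) ≠ 1)) hδB
  filter_upwards [hlow, hr.eventually_gt_atTop 0,
    (tendsto_alphabet hm hnm).eventually hex,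
    -- The intermediate level 1 + τ - δ/2 leaves room for the ceiling in k and for the error in the
    -- threshold.
    hk.eventually_lt_const (show (1 + τ - δ) / 2 < (1 + τ - δ / 2) / 2 by linarith),
    hthr.eventually_const_lt (show 1 + τ - δ / 2 < 1 + τ by linarith)] with n h1 h2 h3 h4 h5
  obtain ⟨q, hq, hqC, hqK⟩ := h3
  refine ⟨q, hq, h1.trans ?_⟩
  rw [← hqK]
  refine le_decisionProb_false hv2 hv hq.1 (by linarith) (fun j => ?_) ?_
  · calc q j * ((1 + δ) * n) ≤ C / m n * ((1 + δ) * n) :=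
          mul_le_mul_of_nonneg_right (hqC j) (by positivity)
      _ = _ := by ring
  · rw [div_lt_iff₀ h2] at h4
    rw [lt_div_iff₀ h2] at h5
    linarith

end asymptotics

/-! ### From exponential bounds to generalized error exponents -/

/-- Upper exponential bounds give lower bounds for the generalized error exponent. -/
lemma le_genExponent {m : ℕ → ℕ} {P : ℕ → ℝ≥0∞} {c : ℝ}
    (hr : ∀ᶠ n : ℕ in atTop, 0 < (n : ℝ) ^ 2 / m n)
    (h : ∀ b > -c, ∀ᶠ n : ℕ in atTop, P n ≤ ENNReal.ofReal (Real.exp ((n : ℝ) ^ 2 / m n * b))) :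
    (c : EReal) ≤ genExponent m P := by
  rw [genExponent, EReal.le_neg]
  refine EReal.le_of_forall_lt_iff_le.1 fun b hb => ?_
  rw [← EReal.coe_neg, EReal.coe_lt_coe_iff] at hb
  refine limsup_le_of_le (by isBoundedDefault) ?_
  filter_upwards [h b hb, hr] with n h1 h2
  have h3 : ENNReal.log (P n) ≤ (((n : ℝ) ^ 2 / m n * b : ℝ) : EReal) := by
    refine (ENNReal.log_le_log h1).trans (le_of_eq ?_)
    rw [ENNReal.log_ofReal_of_pos (Real.exp_pos _), Real.log_exp]
  calc _ ≤ ((1 / ((n : ℝ) ^ 2 / m n) : ℝ) : EReal) * (((n : ℝ) ^ 2 / m n * b : ℝ) : EReal) :=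
        mul_le_mul_of_nonneg_left h3 (by exact_mod_cast (one_div_pos.2 h2).le)
    _ = (b : EReal) := by
        rw [← EReal.coe_mul]
        rw [EReal.coe_eq_coe_iff, one_div, inv_mul_cancel_left₀ h2.ne']

/-- Lower exponential bounds give upper bounds for the generalized error exponent. -/
lemma genExponent_le {m : ℕ → ℕ} {P : ℕ → ℝ≥0∞} {c : ℝ}
    (hr : ∀ᶠ n : ℕ in atTop, 0 < (n : ℝ) ^ 2 / m n)
    (h : ∀ b > c, ∀ᶠ n : ℕ in atTop,
      ENNReal.ofReal (Real.exp (-((n : ℝ) ^ 2 / m n * b))) ≤ P n) :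
    genExponent m P ≤ (c : EReal) := by
  refine EReal.le_of_forall_lt_iff_le.1 fun b hb => ?_
  rw [EReal.coe_lt_coe_iff] at hb
  rw [genExponent, EReal.neg_le, ← EReal.coe_neg]
  refine le_limsup_of_frequently_le (Eventually.frequently ?_) (by isBoundedDefault)
  filter_upwards [h b hb, hr] with n h1 h2
  have h3 : ((-((n : ℝ) ^ 2 / m n * b) : ℝ) : EReal) ≤ ENNReal.log (P n) := by
    refine le_trans (le_of_eq ?_) (ENNReal.log_le_log h1)
    rw [ENNReal.log_ofReal_of_pos (Real.exp_pos _), Real.log_exp]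
  calc ((-b : ℝ) : EReal)
      = ((1 / ((n : ℝ) ^ 2 / m n) : ℝ) : EReal) * ((-((n : ℝ) ^ 2 / m n * b) : ℝ) : EReal) := by
        rw [← EReal.coe_mul]
        rw [EReal.coe_eq_coe_iff, one_div, mul_neg, inv_mul_cancel_left₀ h2.ne']
    _ ≤ _ := mul_le_mul_of_nonneg_left h3 (by exact_mod_cast (one_div_pos.2 h2).le)

lemma one_le_kappa {ε : ℝ} (hε0 : 0 < ε) (hε1 : ε < 1) : 1 ≤ kappa ε := by
  have : 0 < 1 - ε := by linarith
  unfold kappa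
  split_ifs
  · nlinarith
  · exact le_add_of_nonneg_right (by positivity)

end

end SmallSample

theorem mainTheorem5 (ε : ℝ) (hε0 : 0 < ε) (hε1 : ε < 1)
    (m : ℕ → ℕ) (hm : ∀ n, 0 < m n)
    (hnm : (fun n : ℕ => (n : ℝ)) =o[atTop] fun n => (m n : ℝ))
    (hmn : (fun n : ℕ => (m n : ℝ)) =o[atTop] fun n => (n : ℝ) ^ 2)
    (L : ℕ) (v : ℕ → ℝ) (hv2 : v 2 = 0) (hv : ∀ l, 3 ≤ l → l ≤ L → 0 ≤ v l)
    (τ : ℝ) (hτ : τ ∈ Set.Icc 0 (kappa ε - 1))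
    (t : ℕ → ℝ) (ht : Tendsto (fun n : ℕ => (m n : ℝ) * t n / (n : ℝ) ^ 2) atTop (𝓝 τ)) :
    expFA m (fun n => modTest L v n (m n) (t n)) = optFA τ ∧
      expMD ε m (fun n => modTest L v n (m n) (t n)) = optMD ε τ := by
  have hr := (tendsto_normalization hm hmn).eventually_gt_atTop 0
  have hτ0 : 0 < 1 + τ := by linarith [hτ.1]
  have hκ0 : 0 < kappa ε := by linarith [one_le_kappa hε0 hε1]
  refine ⟨le_antisymm ?_ (iSup_le fun θ => ?_), le_antisymm ?_ (iSup_le fun θ => ?_)⟩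
  -- The stationary point e^{2θ} = 1 + τ of the false alarm objective, where its value is the
  -- Poisson rate from the pair event.
  · have hθ : 0 ≤ Real.log (1 + τ) / 2 :=
      div_nonneg (Real.log_nonneg (by linarith [hτ.1])) two_pos.le
    refine le_trans (genExponent_le hr fun b hb => ?_)
      (le_iSup (fun θ : ℝ≥0 => ((θ * τ - 1 / 2 * (Real.exp (2 * θ) - (1 + 2 * θ)) : ℝ) : EReal))
        ⟨Real.log (1 + τ) / 2, hθ⟩)
    change _ > Real.log (1 + τ) / 2 * τ - 1 / 2 * (Real.exp (2 * (Real.log (1 + τ) / 2))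
      - (1 + 2 * (Real.log (1 + τ) / 2))) at hb
    rw [mul_div_cancel₀ _ two_ne_zero, Real.exp_log hτ0] at hb
    filter_upwards [eventually_le_falseAlarm hm hnm hmn hv2 hv ht hτ.1
      (B := b) (by linarith)] with n hn
    exact ENNReal.ofReal_le_ofReal hn
  · refine le_genExponent hr fun b hb => ?_
    filter_upwards [eventually_falseAlarm_le hm hnm hmn hv2 hv ht θ.coe_nonneg
      (b := b) (by linarith)] with n hn
    exact ENNReal.ofReal_le_ofReal hn
  -- The stationary point κ e^{-2θ} = 1 + τ of the missed detection objective; it is admissible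
  -- because τ ≤ κ - 1.
  · have hθ : 0 ≤ Real.log (kappa ε / (1 + τ)) / 2 := by
      refine div_nonneg (Real.log_nonneg ?_) two_pos.le
      rw [one_le_div hτ0]
      linarith [hτ.2]
    refine le_trans (genExponent_le hr fun b hb => ?_)
      (le_iSup (fun θ : ℝ≥0 => ((θ * (kappa ε - 1 - τ)
        - 1 / 2 * (Real.exp (-2 * θ) - (1 - 2 * θ)) * kappa ε : ℝ) : EReal))
        ⟨Real.log (kappa ε / (1 + τ)) / 2, hθ⟩)
    have h1 : Real.exp (-2 * (Real.log (kappa ε / (1 + τ)) / 2)) * kappa ε = 1 + τ := by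
      rw [show -2 * (Real.log (kappa ε / (1 + τ)) / 2) = -Real.log (kappa ε / (1 + τ)) by ring,
        ← Real.log_inv, inv_div, Real.exp_log (by positivity)]
      field_simp
    have h2 : Real.log ((1 + τ) / kappa ε) = -Real.log (kappa ε / (1 + τ)) := by
      rw [← Real.log_inv, inv_div]
    change _ > Real.log (kappa ε / (1 + τ)) / 2 * (kappa ε - 1 - τ)
      - 1 / 2 * (Real.exp (-2 * (Real.log (kappa ε / (1 + τ)) / 2))
        - (1 - 2 * (Real.log (kappa ε / (1 + τ)) / 2))) * kappa ε at hb
    filter_upwards [eventually_le_missedDetection hm hnm hmn hv2 hv ht hε0 hε1 hτ.1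
      (B := b) (by rw [h2]; linarith)] with n hn
    obtain ⟨q, hq, hqn⟩ := hn
    exact (ENNReal.ofReal_le_ofReal hqn).trans
      (le_iSup₂ (f := fun q _ => ENNReal.ofReal (decisionProb q (modTest L v n (m n) (t n)) false))
        q hq)
  · refine le_genExponent hr fun b hb => ?_
    filter_upwards [eventually_missedDetection_le hm hnm hmn hv2 hv ht hε0 hε1 θ.coe_nonneg
      (b := b) (by linarith)] with n hn
    exact iSup₂_le fun q hq => ENNReal.ofReal_le_ofReal (hn q hq)
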